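/- Let $(M,g)$ be a compact smooth Riemannian manifold without boundary, of any dimension, and let $n,k\in\mathbf R$ with $n\neq 0,1,2$ and $k\neq 0$ ($n$ need not be the dimension of $M$). Fix a smooth function $\varphi$ on $M$. For a positive smooth function $f$ on $M$ put $$s_{g,f,k,n,\varphi}=f^{-k}\Big\{\varphi+k(n-1)\frac1f\,\Delta_g f+\frac k4(n-1)(4+2k-kn)\frac1{f^2}|df|_g^2\Big\},$$ where $\Delta_g=d^*d=-\operatorname{div}\operatorname{grad}$ is the (nonnegative) Hodge Laplacian of $g$ on functions, and $$S(g,f,k,n,\varphi)=\int_M s_{g,f,k,n,\varphi}\,f^{\frac{nk}2}\,dv_g,\qquad \mathrm{Vol}(g,f,k,n)=\int_M f^{\frac{nk}2}\,dv_g,$$ $$EH(g,f,k,n,\varphi)=\frac{S(g,f,k,n,\varphi)}{\mathrm{Vol}(g,f,k,n)^{\frac{n-2}n}},$$ where $dv_g$ is the Riemannian volume measure. A positive smooth function $f$ is called a critical point of $f\mapsto EH(g,f,k,n,\varphi)$ if for every smooth family $f_t$, $t\in(-\varepsilon,\varepsilon)$, of positive functions with $f_0=f$ (smooth jointly in $t$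 and the point of $M$) the derivative $\frac{d}{dt}\big|_{t=0}EH(g,f_t,k,n,\varphi)$ exists and is zero. Then, for every positive smooth function $f$ on $M$, the function $s_{g,f,k,n,\varphi}$ is constant on $M$ if and only if $f$ is a critical point of the functional $f\mapsto EH(g,f,k,n,\varphi)$. -/

import Mathlib

open scoped Manifold ContDiff Bundle

noncomputable section

namespace EinsteinHilbert

variable {d : ℕ} {M : Type*} [TopologicalSpace M] [ChartedSpace (EuclideanSpace ℝ (Fin d)) M]

/-- The `i`-th standard basis vector of `ℝ^d`. -/
def e (i : Fin d) : EuclideanSpace ℝ (Fin d) := EuclideanSpace.single i 1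

/-- The coordinate vector field `∂_i` of the chart at `x₀`, at the point with coordinates `y`:
the image of the `i`-th standard basis vector under the differential of the inverse chart. -/
def coordVector (x₀ : M) (y : EuclideanSpace ℝ (Fin d)) (i : Fin d) :
    TangentSpace (𝓡 d) ((extChartAt (𝓡 d) x₀).symm y) :=
  mfderiv 𝓘(ℝ, EuclideanSpace ℝ (Fin d)) (𝓡 d) (extChartAt (𝓡 d) x₀).symm y (e i)

/-- The partial derivative `∂_i f` in the chart at `x₀`, at the point with coordinates `y`. -/
def coordDeriv (x₀ : M) (f : M → ℝ) (y : EuclideanSpace ℝ (Fin d)) (i : Fin d) : ℝ :=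
  fderiv ℝ (f ∘ (extChartAt (𝓡 d) x₀).symm) y (e i)

/-- The divergence form expression `(det g)^{-1/2} ∑ i, ∂_i ((det g)^{1/2} X^i)`, at `y`, for a
matrix field `G = (g_ij)` and a vector field `X` on an open subset of `ℝ^d`. -/
def coordDivergence (G : EuclideanSpace ℝ (Fin d) → Matrix (Fin d) (Fin d) ℝ)
    (X : EuclideanSpace ℝ (Fin d) → Fin d → ℝ) (y : EuclideanSpace ℝ (Fin d)) : ℝ :=
  (√(G y).det)⁻¹ * ∑ i, fderiv ℝ (fun z => √(G z).det * X z i) y (e i)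

variable [IsManifold (𝓡 d) ∞ M]

/-- Smooth Riemannian metrics on a `d`-dimensional smooth manifold (without boundary). -/
abbrev SmoothMetric (d : ℕ) (M : Type*) [TopologicalSpace M]
    [ChartedSpace (EuclideanSpace ℝ (Fin d)) M] [IsManifold (𝓡 d) ∞ M] : Type _ :=
  Bundle.ContMDiffRiemannianMetric (𝓡 d) ∞ (EuclideanSpace ℝ (Fin d))
    (fun x : M => TangentSpace (𝓡 d) x)

/-- The matrix `g_ij = g(∂_i, ∂_j)` of the metric in the chart at `x₀`, as a function of the
coordinates `y`. -/
def gram (g : SmoothMetric d M) (x₀ : M) (y : EuclideanSpace ℝ (Fin d)) :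
    Matrix (Fin d) (Fin d) ℝ :=
  Matrix.of fun i j =>
    g.inner ((extChartAt (𝓡 d) x₀).symm y) (coordVector x₀ y i) (coordVector x₀ y j)

/-- The components `(grad f)^i = ∑ j, g^{ij} ∂_j f` of the gradient in the chart at `x₀`. -/
def coordGrad (g : SmoothMetric d M) (x₀ : M) (f : M → ℝ) (y : EuclideanSpace ℝ (Fin d))
    (i : Fin d) : ℝ :=
  ∑ j, (gram g x₀ y)⁻¹ i j * coordDeriv x₀ f y j

/-- `|df|_g^2 = ∑ i j, g^{ij} ∂_i f ∂_j f`, computed at `x` in the chart at `x`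
(the value does not depend on the chart). -/
def normDiffSq (g : SmoothMetric d M) (f : M → ℝ) (x : M) : ℝ :=
  ∑ i, coordDeriv x f (extChartAt (𝓡 d) x x) i * coordGrad g x f (extChartAt (𝓡 d) x x) i

/-- The Hodge Laplacian on functions (nonnegative, `Δ_g = d^* d = - div grad`),
`Δ_g f = - (det g)^{-1/2} ∑ i j, ∂_i ((det g)^{1/2} g^{ij} ∂_j f)`, computed at `x` in the chart
at `x` (the value does not depend on the chart). -/
def hodgeLaplacian (g : SmoothMetric d M) (f : M → ℝ) (x : M) : ℝ :=
  - coordDivergence (gram g x) (coordGrad g x f) (extChartAt (𝓡 d) x x)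

section Volume

variable [MeasurableSpace M]

/-- The Riemannian volume of the domain of the chart at `x₀`: the measure on `M` which is carried
by this domain and reads `(det g)^{1/2} dy` in coordinates. -/
def chartVolume (g : SmoothMetric d M) (x₀ : M) : MeasureTheory.Measure M :=
  ((MeasureTheory.volume.restrict (extChartAt (𝓡 d) x₀).target).withDensity
    (fun y => ENNReal.ofReal (√(gram g x₀ y).det))).map (extChartAt (𝓡 d) x₀).symm

/-- The Riemannian volume measure `dv_g`: the smallest measure on `M` dominating the local volume
measures of all the preferred charts. As these agree on overlaps, this is the measure obtained by
gluing them, i.e. the one that restricts to `chartVolume g x₀` on the domain of the chart at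
`x₀`. -/
def riemVolume (g : SmoothMetric d M) : MeasureTheory.Measure M :=
  ⨆ x₀ : M, chartVolume g x₀

/-- The modified scalar curvature
`s_{g,f,k,n,φ} = f^{-k} (φ + k(n-1) f⁻¹ Δ_g f + (k/4)(n-1)(4+2k-kn) f⁻² |df|_g²)`. -/
def modScalar (g : SmoothMetric d M) (f : M → ℝ) (k n : ℝ) (φ : M → ℝ) (x : M) : ℝ :=
  f x ^ (-k) * (φ x + k * (n - 1) * (1 / f x) * hodgeLaplacian g f x
    + k / 4 * (n - 1) * (4 + 2 * k - k * n) * (1 / f x ^ 2) * normDiffSq g f x)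

/-- `S(g,f,k,n,φ) = ∫_M s_{g,f,k,n,φ} f^{nk/2} dv_g`. -/
def totalModScalar (g : SmoothMetric d M) (f : M → ℝ) (k n : ℝ) (φ : M → ℝ) : ℝ :=
  ∫ x, modScalar g f k n φ x * f x ^ (n * k / 2) ∂(riemVolume g)

/-- `Vol(g,f,k,n) = ∫_M f^{nk/2} dv_g`. -/
def modVolume (g : SmoothMetric d M) (f : M → ℝ) (k n : ℝ) : ℝ :=
  ∫ x, f x ^ (n * k / 2) ∂(riemVolume g)

/-- The normalized functional `EH(g,f,k,n,φ) = S(g,f,k,n,φ) / Vol(g,f,k,n)^{(n-2)/n}`. -/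
def EH (g : SmoothMetric d M) (f : M → ℝ) (k n : ℝ) (φ : M → ℝ) : ℝ :=
  totalModScalar g f k n φ / modVolume g f k n ^ ((n - 2) / n)

end Volume

/-- `f` is a critical point of the functional `Φ` on positive smooth functions: for every smooth
family `F t`, `t ∈ (-ε, ε)`, of positive functions with `F 0 = f` (smooth meaning jointly smooth in
`(t, x)`), the derivative of `Φ (F t)` at `t = 0` exists and is zero. -/
def IsCriticalPoint (d : ℕ) {M : Type*} [TopologicalSpace M]
    [ChartedSpace (EuclideanSpace ℝ (Fin d)) M] (Φ : (M → ℝ) → ℝ) (f : M → ℝ) : Prop :=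
  ∀ (ε : ℝ) (F : ℝ → M → ℝ), 0 < ε →
    ContMDiffOn (𝓘(ℝ, ℝ).prod (𝓡 d)) 𝓘(ℝ, ℝ) ∞ (fun p : ℝ × M => F p.1 p.2)
      (Set.Ioo (-ε) ε ×ˢ Set.univ) →
    (∀ t ∈ Set.Ioo (-ε) ε, ∀ x, 0 < F t x) →
    F 0 = f →
    HasDerivAt (fun t => Φ (F t)) 0 0

end EinsteinHilbert

end

noncomputable section

open scoped Topology

namespace EinsteinHilbert

open MeasureTheory

/-! ### Change of charts for the metric and for differentials. -/

section

variable {d : ℕ} {M : Type*} [TopologicalSpace M] [ChartedSpace (EuclideanSpace ℝ (Fin d)) M]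

/-! The proof computes the first variation of `EH`. Put a = k(n-2)/2. Green's formula with weight
f^(a-1) removes the Laplacian from S and leaves the first-order expression S = ∫ φ f^a +
(k²/4)(n-1)(n-2) f^(a-2) |df|² (`totalModScalar_eq`). Differentiating this along a family with
velocity h, then applying Green's formula with weight f^(a-2) to move the derivative off h, restores
the Laplacian and gives dS(h) = (k(n-2)/2) ∫ f^(nk/2-1) s h (`hasDerivAt_totalModScalar`). Since
dVol(h) = (nk/2) ∫ f^(nk/2-1) h, the quotient rule yields (`hasDerivAt_EH`) dEH(h) = (k(n-2)/2)
Vol^(-(n-2)/n) ∫ h f^(nk/2-1) (s - S/Vol). If s is a constant c, then S = c Vol and the integrand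
vanishes. Conversely, the variations f + t h realise every smooth h, the prefactor is nonzero
because k ≠ 0 and n ≠ 2, and f > 0, so s = S/Vol everywhere.

The geometric input is Green's formula `integral_mul_hodgeLaplacian` for operators and a measure
defined through charts. The change of variables formula shows that the chart volumes agree on
overlaps. In one chart, Green's formula is the vanishing of the integral of a compactly supported
divergence; a partition of unity makes it global. The Laplacian is shown to be independent of the
chart weakly: its pairing with test functions equals ∫ ⟨dh, df⟩, which mentions no chart. -/

lemma sum_smul_e (v : EuclideanSpace ℝ (Fin d)) : ∑ i, v i • e i = v := by
  ext j
  simp [e, Finset.sum_apply, Pi.single_apply]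

lemma clm_apply_eq_sum {F : Type*} [NormedAddCommGroup F] [NormedSpace ℝ F]
    (L : EuclideanSpace ℝ (Fin d) →L[ℝ] F) (v : EuclideanSpace ℝ (Fin d)) :
    L v = ∑ i, v i • L (e i) := by
  conv_lhs => rw [← sum_smul_e v]
  simp

/-- The change of coordinates from the chart at `x₁` to the chart at `x₀`. -/
def transition (x₁ x₀ : M) : EuclideanSpace ℝ (Fin d) → EuclideanSpace ℝ (Fin d) :=
  extChartAt (𝓡 d) x₀ ∘ (extChartAt (𝓡 d) x₁).symm

/-- The coordinates, in the chart at `x₁`, of the points in the domain of the chart at `x₀`. -/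
def overlap (d : ℕ) {M : Type*} [TopologicalSpace M]
    [ChartedSpace (EuclideanSpace ℝ (Fin d)) M] (x₁ x₀ : M) : Set (EuclideanSpace ℝ (Fin d)) :=
  (extChartAt (𝓡 d) x₁).target ∩ (extChartAt (𝓡 d) x₁).symm ⁻¹' (extChartAt (𝓡 d) x₀).source

/-- The transposed Jacobian matrix of the change of coordinates. -/
def jacobian (x₁ x₀ : M) (y : EuclideanSpace ℝ (Fin d)) : Matrix (Fin d) (Fin d) ℝ :=
  Matrix.of fun i j => fderiv ℝ (transition x₁ x₀) y (e i) j

lemma isOpen_overlap (x₁ x₀ : M) : IsOpen (overlap d x₁ x₀) :=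
  (continuousOn_extChartAt_symm x₁).isOpen_inter_preimage (isOpen_extChartAt_target x₁)
    (isOpen_extChartAt_source x₀)

lemma symm_transition {x₁ x₀ : M} {y : EuclideanSpace ℝ (Fin d)} (hy : y ∈ overlap d x₁ x₀) :
    (extChartAt (𝓡 d) x₀).symm (transition x₁ x₀ y) = (extChartAt (𝓡 d) x₁).symm y :=
  (extChartAt (𝓡 d) x₀).left_inv hy.2

lemma transition_mem_target {x₁ x₀ : M} {y : EuclideanSpace ℝ (Fin d)}
    (hy : y ∈ overlap d x₁ x₀) : transition x₁ x₀ y ∈ (extChartAt (𝓡 d) x₀).target :=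
  (extChartAt (𝓡 d) x₀).map_source hy.2

lemma mem_overlap {x₁ x₀ p : M} (h₁ : p ∈ (extChartAt (𝓡 d) x₁).source)
    (h₀ : p ∈ (extChartAt (𝓡 d) x₀).source) : extChartAt (𝓡 d) x₁ p ∈ overlap d x₁ x₀ :=
  ⟨(extChartAt (𝓡 d) x₁).map_source h₁, by rwa [Set.mem_preimage, (extChartAt (𝓡 d) x₁).left_inv h₁]⟩

lemma transition_extChartAt {x₁ x₀ p : M} (h₁ : p ∈ (extChartAt (𝓡 d) x₁).source) :
    transition x₁ x₀ (extChartAt (𝓡 d) x₁ p) = extChartAt (𝓡 d) x₀ p := by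
  rw [transition, Function.comp_apply, (extChartAt (𝓡 d) x₁).left_inv h₁]

lemma eventuallyEq_transition {x₁ x₀ : M} {y : EuclideanSpace ℝ (Fin d)}
    (hy : y ∈ overlap d x₁ x₀) :
    (extChartAt (𝓡 d) x₁).symm =ᶠ[𝓝 y] (extChartAt (𝓡 d) x₀).symm ∘ transition x₁ x₀ := by
  filter_upwards [(isOpen_overlap x₁ x₀).mem_nhds hy] with z hz
  exact (symm_transition hz).symm

/-- Rows are indexed by the direction of differentiation, so the matrix is the transpose of the
usual one; the determinant does not see this. -/
lemma det_jacobian (x₁ x₀ : M) (y : EuclideanSpace ℝ (Fin d)) :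
    (jacobian x₁ x₀ y).det = (fderiv ℝ (transition x₁ x₀) y).det := by
  rw [ContinuousLinearMap.det,
    ← LinearMap.det_toMatrix (EuclideanSpace.basisFun (Fin d) ℝ).toBasis,
    ← Matrix.det_transpose]
  rfl

/-- The metric changes by congruence and covectors by the same matrix, so the factors cancel in the
dual form. This is why ⟨df, dh⟩ does not depend on the chart. -/
lemma dotProduct_inv_mulVec_of_congruence {A G G' : Matrix (Fin d) (Fin d) ℝ}
    (hA : IsUnit A.det) (hG : G' = A * G * A.transpose) (α β : Fin d → ℝ) :
    dotProduct (A.mulVec α) (G'⁻¹.mulVec (A.mulVec β)) = dotProduct α (G⁻¹.mulVec β) := by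
  have h1 : A⁻¹ * A = 1 := Matrix.nonsing_inv_mul A hA
  have h2 : A.transpose * A.transpose⁻¹ = 1 := Matrix.mul_nonsing_inv _ (by simpa using hA)
  rw [hG, Matrix.mul_inv_rev, Matrix.mul_inv_rev, Matrix.mulVec_mulVec,
    Matrix.dotProduct_mulVec, Matrix.vecMul_mulVec, ← Matrix.dotProduct_mulVec]
  congr 2
  calc A.transpose * (A.transpose⁻¹ * (G⁻¹ * A⁻¹) * A)
      = (A.transpose * A.transpose⁻¹) * G⁻¹ * (A⁻¹ * A) := by simp only [Matrix.mul_assoc]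
    _ = G⁻¹ := by rw [h1, h2]; simp

variable [IsManifold (𝓡 d) ∞ M]

lemma contMDiffAt_extChartAt_symm {x₀ : M} {y : EuclideanSpace ℝ (Fin d)}
    (hy : y ∈ (extChartAt (𝓡 d) x₀).target) :
    ContMDiffAt 𝓘(ℝ, EuclideanSpace ℝ (Fin d)) (𝓡 d) ∞ (extChartAt (𝓡 d) x₀).symm y :=
  (contMDiffOn_extChartAt_symm x₀).contMDiffAt ((isOpen_extChartAt_target x₀).mem_nhds hy)

lemma contDiffOn_transition (x₁ x₀ : M) :
    ContDiffOn ℝ ∞ (transition x₁ x₀) (overlap d x₁ x₀) := by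
  rw [← contMDiffOn_iff_contDiffOn]
  have h0 : ContMDiffOn (𝓡 d) 𝓘(ℝ, EuclideanSpace ℝ (Fin d)) ∞ (extChartAt (𝓡 d) x₀)
      (extChartAt (𝓡 d) x₀).source := by
    rw [extChartAt_source]; exact contMDiffOn_extChartAt
  exact h0.comp ((contMDiffOn_extChartAt_symm x₁).mono Set.inter_subset_left)
    Set.inter_subset_right

lemma differentiableAt_transition {x₁ x₀ : M} {y : EuclideanSpace ℝ (Fin d)}
    (hy : y ∈ overlap d x₁ x₀) : DifferentiableAt ℝ (transition x₁ x₀) y :=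
  ((contDiffOn_transition x₁ x₀).contDiffAt ((isOpen_overlap x₁ x₀).mem_nhds hy)).differentiableAt
    (by simp)

/-- The scalar product at `p`, with tangent vectors seen in the model space. -/
def metricAt (g : SmoothMetric d M) (p : M) (v w : EuclideanSpace ℝ (Fin d)) : ℝ :=
  g.inner p (v : TangentSpace (𝓡 d) p) (w : TangentSpace (𝓡 d) p)

/-- The differential of the inverse chart. -/
def chartFrame (x₀ : M) (y : EuclideanSpace ℝ (Fin d)) :
    EuclideanSpace ℝ (Fin d) →L[ℝ] EuclideanSpace ℝ (Fin d) :=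
  mfderiv 𝓘(ℝ, EuclideanSpace ℝ (Fin d)) (𝓡 d) (extChartAt (𝓡 d) x₀).symm y

lemma chartFrame_injective {x₀ : M} {y : EuclideanSpace ℝ (Fin d)}
    (hy : y ∈ (extChartAt (𝓡 d) x₀).target) :
    Function.Injective (chartFrame x₀ y) := by
  have : IsManifold (𝓡 d) 1 M := IsManifold.of_le (n := ∞) (by simp)
  have := isInvertible_mfderivWithin_extChartAt_symm (I := 𝓡 d) (x := x₀) hy
  simp only [modelWithCornersSelf_coe, Set.range_id, mfderivWithin_univ] at this
  exact this.injective

lemma gram_apply (g : SmoothMetric d M) (x₀ : M) (y : EuclideanSpace ℝ (Fin d)) (i j : Fin d) :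
    gram g x₀ y i j = metricAt g ((extChartAt (𝓡 d) x₀).symm y) (chartFrame x₀ y (e i))
      (chartFrame x₀ y (e j)) := rfl

lemma metricAt_sum (g : SmoothMetric d M) (p : M) (a b : Fin d → ℝ)
    (v w : Fin d → EuclideanSpace ℝ (Fin d)) :
    metricAt g p (∑ i, a i • v i) (∑ j, b j • w j) =
      ∑ i, ∑ j, a i * b j * metricAt g p (v i) (w j) := by
  let B : EuclideanSpace ℝ (Fin d) →L[ℝ] EuclideanSpace ℝ (Fin d) →L[ℝ] ℝ := g.inner p
  change B _ _ = ∑ i, ∑ j, a i * b j * B _ _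
  simp only [map_sum, map_smul, FunLike.coe_sum, FunLike.coe_smul,
    Finset.sum_apply, Pi.smul_apply, smul_eq_mul, Finset.mul_sum]
  rw [Finset.sum_comm]
  exact Finset.sum_congr rfl fun i _ => Finset.sum_congr rfl fun j _ => by ring

lemma gram_posDef (g : SmoothMetric d M) {x₀ : M} {y : EuclideanSpace ℝ (Fin d)}
    (hy : y ∈ (extChartAt (𝓡 d) x₀).target) : (gram g x₀ y).PosDef := by
  rw [Matrix.posDef_iff_dotProduct_mulVec]
  refine ⟨?_, fun {v} hv => ?_⟩
  · ext i j
    simp only [Matrix.conjTranspose_apply, star_trivial]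
    exact g.symm _ _ _
  · have hne : (WithLp.toLp 2 v : EuclideanSpace ℝ (Fin d)) ≠ 0 := by simpa using hv
    have h1 : chartFrame x₀ y (WithLp.toLp 2 v) ≠ 0 := by
      intro h
      exact hne (chartFrame_injective hy (h.trans (map_zero _).symm))
    have h2 : 0 < metricAt g ((extChartAt (𝓡 d) x₀).symm y) (chartFrame x₀ y (WithLp.toLp 2 v))
        (chartFrame x₀ y (WithLp.toLp 2 v)) := g.pos _ _ h1
    rw [clm_apply_eq_sum (chartFrame x₀ y), metricAt_sum] at h2
    refine h2.trans_eq ?_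
    simp only [dotProduct, Matrix.mulVec, star_trivial, gram_apply, Finset.mul_sum]
    exact Finset.sum_congr rfl fun i _ => Finset.sum_congr rfl fun j _ => by ring

lemma chartFrame_transition {x₁ x₀ : M} {y : EuclideanSpace ℝ (Fin d)}
    (hy : y ∈ overlap d x₁ x₀) (v : EuclideanSpace ℝ (Fin d)) :
    chartFrame x₁ y v = chartFrame x₀ (transition x₁ x₀ y) (fderiv ℝ (transition x₁ x₀) y v) := by
  have h1 : mfderiv 𝓘(ℝ, EuclideanSpace ℝ (Fin d)) (𝓡 d) (extChartAt (𝓡 d) x₁).symm y =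
      mfderiv 𝓘(ℝ, EuclideanSpace ℝ (Fin d)) (𝓡 d)
        ((extChartAt (𝓡 d) x₀).symm ∘ transition x₁ x₀) y :=
    (eventuallyEq_transition hy).mfderiv_eq
  have h2 := mfderiv_comp (I := 𝓘(ℝ, EuclideanSpace ℝ (Fin d)))
    (I' := 𝓘(ℝ, EuclideanSpace ℝ (Fin d))) (I'' := 𝓡 d) y
    ((contMDiffAt_extChartAt_symm (transition_mem_target hy)).mdifferentiableAt (by simp))
    (differentiableAt_transition hy).mdifferentiableAt
  have h3 := h1.trans h2
  rw [mfderiv_eq_fderiv] at h3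
  exact congrArg (fun L => L v) h3

lemma gram_transition (g : SmoothMetric d M) {x₁ x₀ : M} {y : EuclideanSpace ℝ (Fin d)}
    (hy : y ∈ overlap d x₁ x₀) :
    gram g x₁ y = jacobian x₁ x₀ y * gram g x₀ (transition x₁ x₀ y) *
      (jacobian x₁ x₀ y).transpose := by
  ext i j
  rw [gram_apply, chartFrame_transition hy, chartFrame_transition hy,
    clm_apply_eq_sum (chartFrame x₀ _), clm_apply_eq_sum (chartFrame x₀ _) (fderiv ℝ _ y (e j)),
    metricAt_sum, ← symm_transition hy]
  simp only [Matrix.mul_apply, Matrix.transpose_apply, Finset.sum_mul]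
  rw [Finset.sum_comm]
  refine Finset.sum_congr rfl fun b _ => Finset.sum_congr rfl fun a _ => ?_
  rw [gram_apply]
  simp only [jacobian, Matrix.of_apply]
  ring

/-- The factor on the right is the Jacobian of the change of variables formula; this makes the
Riemannian density chart-independent. -/
lemma sqrt_det_gram_transition (g : SmoothMetric d M) {x₁ x₀ : M}
    {y : EuclideanSpace ℝ (Fin d)} (hy : y ∈ overlap d x₁ x₀) :
    √(gram g x₁ y).det =
      |(fderiv ℝ (transition x₁ x₀) y).det| * √(gram g x₀ (transition x₁ x₀ y)).det := by
  rw [gram_transition g hy, Matrix.det_mul, Matrix.det_mul, Matrix.det_transpose, ← det_jacobian]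
  have : (jacobian x₁ x₀ y).det * (gram g x₀ (transition x₁ x₀ y)).det * (jacobian x₁ x₀ y).det =
    (jacobian x₁ x₀ y).det ^ 2 * (gram g x₀ (transition x₁ x₀ y)).det := by ring
  rw [this, Real.sqrt_mul (sq_nonneg _), Real.sqrt_sq_eq_abs]

/-- The Gram determinant in one chart is (det J)² times that in the other, and it is positive; so
det J cannot vanish. -/
lemma isUnit_det_jacobian (g : SmoothMetric d M) {x₁ x₀ : M}
    {y : EuclideanSpace ℝ (Fin d)} (hy : y ∈ overlap d x₁ x₀) :
    IsUnit (jacobian x₁ x₀ y).det := by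
  have h := (gram_posDef g hy.1).det_pos
  rw [gram_transition g hy, Matrix.det_mul, Matrix.det_mul] at h
  rw [isUnit_iff_ne_zero]
  intro h0
  simp [h0] at h

lemma coordDeriv_transition {x₁ x₀ : M} {y : EuclideanSpace ℝ (Fin d)}
    (hy : y ∈ overlap d x₁ x₀) {f : M → ℝ}
    (hf : DifferentiableAt ℝ (f ∘ (extChartAt (𝓡 d) x₀).symm) (transition x₁ x₀ y)) :
    coordDeriv x₁ f y =
      (jacobian x₁ x₀ y).mulVec (coordDeriv x₀ f (transition x₁ x₀ y)) := by
  ext i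
  have h1 : f ∘ (extChartAt (𝓡 d) x₁).symm =ᶠ[𝓝 y]
      (f ∘ (extChartAt (𝓡 d) x₀).symm) ∘ transition x₁ x₀ := by
    filter_upwards [eventuallyEq_transition hy] with z hz
    simp only [Function.comp_apply] at hz ⊢
    rw [hz]
  rw [coordDeriv, h1.fderiv_eq, fderiv_comp _ hf (differentiableAt_transition hy),
    ContinuousLinearMap.comp_apply, clm_apply_eq_sum]
  simp [Matrix.mulVec, dotProduct, jacobian, coordDeriv]

/-- The scalar product `⟨df, dh⟩_g` at the point with coordinates `y` in the chart at `x₀`. -/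
def coordInner (g : SmoothMetric d M) (x₀ : M) (f h : M → ℝ) (y : EuclideanSpace ℝ (Fin d)) : ℝ :=
  ∑ i, coordDeriv x₀ f y i * coordGrad g x₀ h y i

/-- The scalar product `⟨df, dh⟩_g`. -/
def innerDiff (g : SmoothMetric d M) (f h : M → ℝ) (x : M) : ℝ :=
  coordInner g x f h (extChartAt (𝓡 d) x x)

lemma coordInner_eq (g : SmoothMetric d M) (x₀ : M) (f h : M → ℝ)
    (y : EuclideanSpace ℝ (Fin d)) :
    coordInner g x₀ f h y =
      dotProduct (coordDeriv x₀ f y) ((gram g x₀ y)⁻¹.mulVec (coordDeriv x₀ h y)) := rfl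

lemma coordInner_transition (g : SmoothMetric d M) {x₁ x₀ : M} {y : EuclideanSpace ℝ (Fin d)}
    (hy : y ∈ overlap d x₁ x₀) {f h : M → ℝ}
    (hf : DifferentiableAt ℝ (f ∘ (extChartAt (𝓡 d) x₀).symm) (transition x₁ x₀ y))
    (hh : DifferentiableAt ℝ (h ∘ (extChartAt (𝓡 d) x₀).symm) (transition x₁ x₀ y)) :
    coordInner g x₁ f h y = coordInner g x₀ f h (transition x₁ x₀ y) := by
  rw [coordInner_eq, coordInner_eq, coordDeriv_transition hy hf, coordDeriv_transition hy hh]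
  exact dotProduct_inv_mulVec_of_congruence (isUnit_det_jacobian g hy) (gram_transition g hy) _ _

/-- The coordinate field is the tangent map of the inverse chart applied to a constant section. -/
lemma contMDiffOn_coordVector (x₀ : M) (i : Fin d) :
    ContMDiffOn 𝓘(ℝ, EuclideanSpace ℝ (Fin d)) ((𝓡 d).prod 𝓘(ℝ, EuclideanSpace ℝ (Fin d))) ∞
      (fun y => (Bundle.TotalSpace.mk' (EuclideanSpace ℝ (Fin d))
        ((extChartAt (𝓡 d) x₀).symm y) (coordVector x₀ y i) : TangentBundle (𝓡 d) M))
      (extChartAt (𝓡 d) x₀).target := by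
  have : IsManifold (𝓡 d) 1 M := IsManifold.of_le (n := ∞) (by simp)
  have ho := isOpen_extChartAt_target (I := 𝓡 d) x₀
  have h1 := (contMDiffOn_extChartAt_symm (I := 𝓡 d) (n := ∞) x₀).contMDiffOn_tangentMapWithin
    (m := ∞) (by simp) ho.uniqueMDiffOn
  let V : (y : EuclideanSpace ℝ (Fin d)) → TangentSpace 𝓘(ℝ, EuclideanSpace ℝ (Fin d)) y :=
    fun _ => e i
  have h2 := (contMDiffOn_vectorSpace_iff_contDiffOn (V := V) (n := ∞)).2
    (contDiffOn_const (c := e i) (s := (extChartAt (𝓡 d) x₀).target))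
  refine (h1.comp h2 fun y hy => hy).congr fun y hy => ?_
  simp only [Function.comp_apply, tangentMapWithin, mfderivWithin_of_isOpen ho hy]
  rfl

lemma contDiffOn_gram (g : SmoothMetric d M) (x₀ : M) (i j : Fin d) :
    ContDiffOn ℝ ∞ (fun y => gram g x₀ y i j) (extChartAt (𝓡 d) x₀).target := by
  have hv (i : Fin d) : ContMDiffOn 𝓘(ℝ, EuclideanSpace ℝ (Fin d))
      ((𝓡 d).prod 𝓘(ℝ, EuclideanSpace ℝ (Fin d))) ∞
      (fun y => (Bundle.TotalSpace.mk' (EuclideanSpace ℝ (Fin d))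
        ((extChartAt (𝓡 d) x₀).symm y) (coordVector x₀ y i) : TangentBundle (𝓡 d) M))
      (extChartAt (𝓡 d) x₀).target := contMDiffOn_coordVector x₀ i
  intro y hy
  rw [← contMDiffWithinAt_iff_contDiffWithinAt]
  have : ContMDiffWithinAt 𝓘(ℝ, EuclideanSpace ℝ (Fin d)) ((𝓡 d).prod 𝓘(ℝ)) ∞
      (fun m ↦ Bundle.TotalSpace.mk' ℝ (E := Bundle.Trivial M ℝ) ((extChartAt (𝓡 d) x₀).symm m)
        (g.inner ((extChartAt (𝓡 d) x₀).symm m) (coordVector x₀ m i) (coordVector x₀ m j)))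
      (extChartAt (𝓡 d) x₀).target y := by
    apply ContMDiffWithinAt.clm_bundle_apply₂ (F₁ := EuclideanSpace ℝ (Fin d))
      (F₂ := EuclideanSpace ℝ (Fin d))
    · exact ContMDiffAt.comp_contMDiffWithinAt y g.contMDiff.contMDiffAt
        (contMDiffAt_extChartAt_symm hy).contMDiffWithinAt
    · exact hv i y hy
    · exact hv j y hy
  simp only [Bundle.contMDiffWithinAt_totalSpace] at this
  exact this.2

end

/-! ### Smoothness of coordinate expressions and chart-independence of ⟨df, dh⟩. -/

section

variable {d : ℕ} {M : Type*} [TopologicalSpace M] [ChartedSpace (EuclideanSpace ℝ (Fin d)) M]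

lemma contDiffOn_det {V : Type*} [NormedAddCommGroup V] [NormedSpace ℝ V]
    {m : WithTop ℕ∞} {s : Set V} {A : V → Matrix (Fin d) (Fin d) ℝ}
    (hA : ∀ i j, ContDiffOn ℝ m (fun y => A y i j) s) :
    ContDiffOn ℝ m (fun y => (A y).det) s := by
  simp only [Matrix.det_apply]
  exact ContDiffOn.sum fun σ _ => (contDiffOn_prod fun i _ => hA _ _).const_smul _

/-- Cramer's rule: each entry is the inverse determinant times the determinant of the matrix with
one row replaced by a constant one. -/
lemma contDiffOn_matrix_inv {V : Type*} [NormedAddCommGroup V] [NormedSpace ℝ V]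
    {m : WithTop ℕ∞} {s : Set V} {A : V → Matrix (Fin d) (Fin d) ℝ}
    (hA : ∀ i j, ContDiffOn ℝ m (fun y => A y i j) s) (hdet : ∀ y ∈ s, (A y).det ≠ 0)
    (i j : Fin d) : ContDiffOn ℝ m (fun y => (A y)⁻¹ i j) s := by
  simp only [Matrix.inv_def, Matrix.smul_apply, Ring.inverse_eq_inv', smul_eq_mul,
    Matrix.adjugate_apply]
  refine ((contDiffOn_det hA).inv hdet).mul (contDiffOn_det fun a b => ?_)
  by_cases h : a = j
  · subst h
    simpa using contDiffOn_const
  · simpa [Matrix.updateRow_ne h] using hA a b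

/-- Partial derivatives of smooth functions on open sets are smooth. -/
lemma contDiffOn_fderiv_apply {V : Type*} [NormedAddCommGroup V] [NormedSpace ℝ V]
    {s : Set V} (hs : IsOpen s) {u : V → ℝ} (hu : ContDiffOn ℝ ∞ u s) (v : V) :
    ContDiffOn ℝ ∞ (fun y => fderiv ℝ u y v) s :=
  (hu.fderiv_of_isOpen hs (by simp)).clm_apply contDiffOn_const

lemma measurableSet_target_inter_preimage [MeasurableSpace M] [BorelSpace M] (x₀ : M)
    {A : Set M} (hA : MeasurableSet A) :
    MeasurableSet ((extChartAt (𝓡 d) x₀).target ∩ (extChartAt (𝓡 d) x₀).symm ⁻¹' A) := by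
  have ht := (isOpen_extChartAt_target (I := 𝓡 d) x₀).measurableSet
  have h1 := (continuousOn_iff_continuous_domRestrict.1
    (continuousOn_extChartAt_symm (I := 𝓡 d) x₀)).measurable hA
  have h2 := ht.subtype_image h1
  convert h2 using 1
  ext y
  simp [and_comm]

variable [IsManifold (𝓡 d) ∞ M] (g : SmoothMetric d M)

lemma gram_det_pos {x₀ : M} {y : EuclideanSpace ℝ (Fin d)}
    (hy : y ∈ (extChartAt (𝓡 d) x₀).target) : 0 < (gram g x₀ y).det :=
  (gram_posDef g hy).det_pos

lemma contDiffOn_sqrt_det_gram (x₀ : M) :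
    ContDiffOn ℝ ∞ (fun y => √(gram g x₀ y).det) (extChartAt (𝓡 d) x₀).target :=
  (contDiffOn_det (contDiffOn_gram g x₀)).sqrt fun _ hy => (gram_det_pos g hy).ne'

lemma contDiffOn_gram_inv (x₀ : M) (i j : Fin d) :
    ContDiffOn ℝ ∞ (fun y => (gram g x₀ y)⁻¹ i j) (extChartAt (𝓡 d) x₀).target :=
  contDiffOn_matrix_inv (contDiffOn_gram g x₀) (fun _ hy => (gram_det_pos g hy).ne') i j

lemma contDiffOn_comp_symm {f : M → ℝ} (hf : ContMDiff (𝓡 d) 𝓘(ℝ, ℝ) ∞ f) (x₀ : M) :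
    ContDiffOn ℝ ∞ (f ∘ (extChartAt (𝓡 d) x₀).symm) (extChartAt (𝓡 d) x₀).target := by
  rw [← contMDiffOn_iff_contDiffOn]
  exact hf.comp_contMDiffOn (contMDiffOn_extChartAt_symm x₀)

lemma differentiableAt_comp_symm {f : M → ℝ} (hf : ContMDiff (𝓡 d) 𝓘(ℝ, ℝ) ∞ f) {x₀ : M}
    {y : EuclideanSpace ℝ (Fin d)} (hy : y ∈ (extChartAt (𝓡 d) x₀).target) :
    DifferentiableAt ℝ (f ∘ (extChartAt (𝓡 d) x₀).symm) y :=
  ((contDiffOn_comp_symm hf x₀).contDiffAt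
    ((isOpen_extChartAt_target x₀).mem_nhds hy)).differentiableAt (by simp)

lemma contDiffOn_coordDeriv {f : M → ℝ} (hf : ContMDiff (𝓡 d) 𝓘(ℝ, ℝ) ∞ f) (x₀ : M)
    (i : Fin d) :
    ContDiffOn ℝ ∞ (fun y => coordDeriv x₀ f y i) (extChartAt (𝓡 d) x₀).target :=
  contDiffOn_fderiv_apply (isOpen_extChartAt_target x₀) (contDiffOn_comp_symm hf x₀) _

lemma contDiffOn_coordGrad {f : M → ℝ} (hf : ContMDiff (𝓡 d) 𝓘(ℝ, ℝ) ∞ f) (x₀ : M)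
    (i : Fin d) :
    ContDiffOn ℝ ∞ (fun y => coordGrad g x₀ f y i) (extChartAt (𝓡 d) x₀).target :=
  ContDiffOn.sum fun j _ => (contDiffOn_gram_inv g x₀ i j).mul (contDiffOn_coordDeriv hf x₀ j)

lemma contDiffOn_coordInner {f h : M → ℝ} (hf : ContMDiff (𝓡 d) 𝓘(ℝ, ℝ) ∞ f)
    (hh : ContMDiff (𝓡 d) 𝓘(ℝ, ℝ) ∞ h) (x₀ : M) :
    ContDiffOn ℝ ∞ (coordInner g x₀ f h) (extChartAt (𝓡 d) x₀).target :=
  ContDiffOn.sum fun i _ => (contDiffOn_coordDeriv hf x₀ i).mul (contDiffOn_coordGrad g hh x₀ i)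

lemma contDiffOn_coordDivergence {f : M → ℝ} (hf : ContMDiff (𝓡 d) 𝓘(ℝ, ℝ) ∞ f) (x₀ : M) :
    ContDiffOn ℝ ∞ (coordDivergence (gram g x₀) (coordGrad g x₀ f))
      (extChartAt (𝓡 d) x₀).target :=
  ((contDiffOn_sqrt_det_gram g x₀).inv fun _ hy => (Real.sqrt_pos.2 (gram_det_pos g hy)).ne').mul
    (ContDiffOn.sum fun i _ => contDiffOn_fderiv_apply (isOpen_extChartAt_target x₀)
      ((contDiffOn_sqrt_det_gram g x₀).mul (contDiffOn_coordGrad g hf x₀ i)) _)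

/-- `⟨df, dh⟩_g` may be computed in any chart. -/
lemma innerDiff_eq {f h : M → ℝ} {x₀ p : M} (hp : p ∈ (extChartAt (𝓡 d) x₀).source)
    (hf : DifferentiableAt ℝ (f ∘ (extChartAt (𝓡 d) x₀).symm) (extChartAt (𝓡 d) x₀ p))
    (hh : DifferentiableAt ℝ (h ∘ (extChartAt (𝓡 d) x₀).symm) (extChartAt (𝓡 d) x₀ p)) :
    innerDiff g f h p = coordInner g x₀ f h (extChartAt (𝓡 d) x₀ p) := by
  have hs := mem_extChartAt_source (I := 𝓡 d) p
  rw [← transition_extChartAt hs] at hf hh ⊢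
  exact coordInner_transition g (mem_overlap hs hp) hf hh

lemma innerDiff_symm_eq {f h : M → ℝ} (hf : ContMDiff (𝓡 d) 𝓘(ℝ, ℝ) ∞ f)
    (hh : ContMDiff (𝓡 d) 𝓘(ℝ, ℝ) ∞ h) {x₀ : M} {y : EuclideanSpace ℝ (Fin d)}
    (hy : y ∈ (extChartAt (𝓡 d) x₀).target) :
    innerDiff g f h ((extChartAt (𝓡 d) x₀).symm y) = coordInner g x₀ f h y := by
  have hr := (extChartAt (𝓡 d) x₀).right_inv hy
  rw [innerDiff_eq g ((extChartAt (𝓡 d) x₀).map_target hy)] <;> rw [hr]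
  exacts [differentiableAt_comp_symm hf hy, differentiableAt_comp_symm hh hy]

/-- The definition uses a different chart at every point. Near x all values are rewritten in the
single chart at x, where the expression is smooth. -/
lemma continuous_innerDiff {f h : M → ℝ} (hf : ContMDiff (𝓡 d) 𝓘(ℝ, ℝ) ∞ f)
    (hh : ContMDiff (𝓡 d) 𝓘(ℝ, ℝ) ∞ h) : Continuous (innerDiff g f h) := by
  rw [continuous_iff_continuousAt]
  intro x
  have hs := extChartAt_source_mem_nhds (I := 𝓡 d) x
  have h1 : ContinuousAt (coordInner g x f h ∘ extChartAt (𝓡 d) x) x :=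
    ContinuousAt.comp ((contDiffOn_coordInner g hf hh x).continuousOn.continuousAt
      (extChartAt_target_mem_nhds x)) (continuousAt_extChartAt x)
  refine h1.congr ?_
  filter_upwards [hs] with p hp
  rw [Function.comp_apply, ← innerDiff_symm_eq g hf hh ((extChartAt (𝓡 d) x).map_source hp),
    (extChartAt (𝓡 d) x).left_inv hp]

/-! ### The Riemannian volume measure. -/

section Measure

variable [MeasurableSpace M] [BorelSpace M]

lemma aemeasurable_symm (x₀ : M) : AEMeasurable (extChartAt (𝓡 d) x₀).symm
    ((volume.restrict (extChartAt (𝓡 d) x₀).target).withDensity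
      (fun y => ENNReal.ofReal (√(gram g x₀ y).det))) :=
  ((continuousOn_extChartAt_symm (I := 𝓡 d) x₀).aemeasurable
    (isOpen_extChartAt_target x₀).measurableSet).mono_ac (withDensity_absolutelyContinuous _ _)

lemma chartVolume_apply (x₀ : M) {A : Set M} (hA : MeasurableSet A) :
    chartVolume g x₀ A = ∫⁻ y in (extChartAt (𝓡 d) x₀).target ∩ (extChartAt (𝓡 d) x₀).symm ⁻¹' A,
      ENNReal.ofReal (√(gram g x₀ y).det) := by
  have ht := (isOpen_extChartAt_target (I := 𝓡 d) x₀).measurableSet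
  rw [chartVolume, Measure.map_apply_of_aemeasurable (aemeasurable_symm g x₀) hA,
    withDensity_apply', Measure.restrict_restrict₀', Set.inter_comm]
  exact ht.nullMeasurableSet

lemma chartVolume_restrict_source (x₀ : M) :
    (chartVolume g x₀).restrict (extChartAt (𝓡 d) x₀).source = chartVolume g x₀ := by
  ext A hA
  rw [Measure.restrict_apply hA, chartVolume_apply g _ hA, chartVolume_apply g _
    (hA.inter (isOpen_extChartAt_source (I := 𝓡 d) x₀).measurableSet)]
  congr 2
  ext y
  simp only [Set.mem_inter_iff, Set.mem_preimage]
  exact ⟨fun h => ⟨h.1, h.2.1⟩, fun h => ⟨h.1, h.2, (extChartAt (𝓡 d) x₀).map_target h.1⟩⟩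

/-- Change of variables along the transition map, whose Jacobian is absorbed by the density. -/
lemma chartVolume_overlap (x₀ x₁ : M) {A : Set M} (hA : MeasurableSet A)
    (h₀ : A ⊆ (extChartAt (𝓡 d) x₀).source) (h₁ : A ⊆ (extChartAt (𝓡 d) x₁).source) :
    chartVolume g x₁ A = chartVolume g x₀ A := by
  rw [chartVolume_apply g _ hA, chartVolume_apply g _ hA]
  set B₁ := (extChartAt (𝓡 d) x₁).target ∩ (extChartAt (𝓡 d) x₁).symm ⁻¹' A with hB₁
  have hsub : B₁ ⊆ overlap d x₁ x₀ := fun y hy => ⟨hy.1, h₀ hy.2⟩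
  have himage : (extChartAt (𝓡 d) x₀).target ∩ (extChartAt (𝓡 d) x₀).symm ⁻¹' A =
      transition x₁ x₀ '' B₁ := by
    ext z
    constructor
    · rintro ⟨hz, hzA⟩
      have hz1 := h₁ hzA
      refine ⟨extChartAt (𝓡 d) x₁ ((extChartAt (𝓡 d) x₀).symm z),
        ⟨(extChartAt (𝓡 d) x₁).map_source hz1, ?_⟩, ?_⟩
      · rwa [Set.mem_preimage, (extChartAt (𝓡 d) x₁).left_inv hz1]
      · rw [transition_extChartAt hz1, (extChartAt (𝓡 d) x₀).right_inv hz]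
    · rintro ⟨y, hy, rfl⟩
      refine ⟨transition_mem_target (hsub hy), ?_⟩
      rw [Set.mem_preimage, symm_transition (hsub hy)]
      exact hy.2
  have hinj : Set.InjOn (transition x₁ x₀) B₁ := by
    intro y hy z hz h
    have h2 := congrArg (extChartAt (𝓡 d) x₀).symm h
    rw [symm_transition (hsub hy), symm_transition (hsub hz)] at h2
    exact (extChartAt (𝓡 d) x₁).symm.injOn hy.1 hz.1 h2
  have hm : MeasurableSet B₁ := measurableSet_target_inter_preimage x₁ hA
  rw [himage, lintegral_image_eq_lintegral_abs_det_fderiv_mul volume hm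
    (fun y hy => (differentiableAt_transition (hsub hy)).hasFDerivAt.hasFDerivWithinAt) hinj]
  refine setLIntegral_congr_fun hm fun y hy => ?_
  rw [sqrt_det_gram_transition g (hsub hy), ENNReal.ofReal_mul (abs_nonneg _)]

lemma riemVolume_restrict_source (x₀ : M) :
    (riemVolume g).restrict (extChartAt (𝓡 d) x₀).source = chartVolume g x₀ := by
  have hU := (isOpen_extChartAt_source (I := 𝓡 d) x₀).measurableSet
  set U := (extChartAt (𝓡 d) x₀).source
  have hself : (chartVolume g x₀).restrict U = chartVolume g x₀ := chartVolume_restrict_source g x₀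
  apply le_antisymm
  -- Each chart volume is split along U. Its part inside U is at most the volume of the chart at x₀,
  -- by agreement on overlaps; its part outside is crudely bounded by the top measure, which
  -- disappears on restricting to U. No countable cover by charts is needed.
  · have hle : riemVolume g ≤ chartVolume g x₀ + (⊤ : Measure M).restrict Uᶜ := by
      refine iSup_le fun x₁ => ?_
      rw [← Measure.restrict_add_restrict_compl (μ := chartVolume g x₁) hU]
      refine add_le_add ?_ (Measure.restrict_mono le_rfl le_top)
      refine Measure.le_iff.2 fun A hA => ?_
      rw [Measure.restrict_apply hA, ← chartVolume_restrict_source g x₁, Measure.restrict_apply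
        (hA.inter hU), chartVolume_overlap g x₀ x₁
          ((hA.inter hU).inter (isOpen_extChartAt_source x₁).measurableSet)
          (fun _ h => h.1.2) (fun _ h => h.2)]
      exact measure_mono fun _ h => h.1.1
    calc (riemVolume g).restrict U
        ≤ (chartVolume g x₀ + (⊤ : Measure M).restrict Uᶜ).restrict U :=
          Measure.restrict_mono le_rfl hle
      _ = chartVolume g x₀ := by
          rw [Measure.restrict_add, hself, Measure.restrict_restrict hU]
          simp
  · rw [← hself]
    exact Measure.restrict_mono le_rfl (le_iSup (fun x => chartVolume g x) x₀)

lemma riemVolume_apply_of_subset_source (x₀ : M) {A : Set M}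
    (h₀ : A ⊆ (extChartAt (𝓡 d) x₀).source) : riemVolume g A = chartVolume g x₀ A := by
  rw [← riemVolume_restrict_source, Measure.restrict_eq_self _ h₀]

instance : IsLocallyFiniteMeasure (riemVolume g) where
  finiteAtNhds x := by
    have hc := (contDiffOn_sqrt_det_gram g x).continuousOn.continuousAt
      (extChartAt_target_mem_nhds x)
    obtain ⟨K, hK, hKt, hKc⟩ := local_compact_nhds (extChartAt_target_mem_nhds (I := 𝓡 d) x)
    set A := interior ((extChartAt (𝓡 d) x).source ∩ extChartAt (𝓡 d) x ⁻¹' K)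
    refine ⟨A, interior_mem_nhds.2 (Filter.inter_mem (extChartAt_source_mem_nhds x)
      ((continuousAt_extChartAt x).preimage_mem_nhds hK)), ?_⟩
    have hA : A ⊆ (extChartAt (𝓡 d) x).source ∩ extChartAt (𝓡 d) x ⁻¹' K := interior_subset
    rw [riemVolume_apply_of_subset_source g x fun p hp => (hA hp).1,
      chartVolume_apply g x isOpen_interior.measurableSet]
    refine (lintegral_mono_set (t := K) ?_).trans_lt ?_
    · rintro y ⟨hy, hyA⟩
      have := (hA hyA).2
      rwa [Set.mem_preimage, (extChartAt (𝓡 d) x).right_inv hy] at this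
    · exact (((contDiffOn_sqrt_det_gram g x).continuousOn.mono hKt).integrableOn_compact
        hKc).lintegral_lt_top

/-- The density is positive. This upgrades almost everywhere equality of continuous functions to
equality everywhere, and makes the volume of a nonempty M positive. -/
instance : (riemVolume g).IsOpenPosMeasure where
  open_pos O hO hne := by
    obtain ⟨x, hx⟩ := hne
    intro h0
    have hop := (continuousOn_extChartAt_symm (I := 𝓡 d) x).isOpen_inter_preimage
      (isOpen_extChartAt_target x) hO
    have h1 : chartVolume g x O = 0 := by
      refine le_antisymm ((Measure.le_iff'.1 (le_iSup (fun x => chartVolume g x) x) O).trans ?_)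
        zero_le
      exact h0.le
    rw [chartVolume_apply g x hO.measurableSet,
      lintegral_eq_zero_iff' (((contDiffOn_sqrt_det_gram g x).continuousOn.mono
        Set.inter_subset_left).aemeasurable hop.measurableSet).ennreal_ofReal,
      Filter.EventuallyEq, ae_restrict_iff' hop.measurableSet] at h1
    have h2 : volume ((extChartAt (𝓡 d) x).target ∩ (extChartAt (𝓡 d) x).symm ⁻¹' O) = 0 := by
      refine measure_mono_null (fun y hy => ?_) h1
      simp only [Set.mem_compl_iff, Set.mem_ofPred_eq, Pi.zero_apply, ENNReal.ofReal_eq_zero,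
        not_le, Classical.not_imp]
      exact ⟨hy, Real.sqrt_pos.2 (gram_det_pos g hy.1)⟩
    refine (hop.measure_pos volume ⟨extChartAt (𝓡 d) x x, mem_extChartAt_target x, ?_⟩).ne' h2
    simpa using hx

lemma integral_riemVolume_eq (x₀ : M) {w : M → ℝ} (hw : Continuous w)
    (hs : Function.support w ⊆ (extChartAt (𝓡 d) x₀).source) :
    ∫ x, w x ∂(riemVolume g) = ∫ y in (extChartAt (𝓡 d) x₀).target,
      √(gram g x₀ y).det * w ((extChartAt (𝓡 d) x₀).symm y) := by
  have ht := (isOpen_extChartAt_target (I := 𝓡 d) x₀).measurableSet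
  rw [← setIntegral_eq_integral_of_forall_compl_eq_zero (s := (extChartAt (𝓡 d) x₀).source)
    fun x hx => by_contra fun h => hx (hs h), riemVolume_restrict_source, chartVolume,
    integral_map (aemeasurable_symm g x₀) hw.measurable.aestronglyMeasurable,
    integral_withDensity_eq_integral_toReal_smul₀
      ((contDiffOn_sqrt_det_gram g x₀).continuousOn.aemeasurable ht).ennreal_ofReal
      (Filter.Eventually.of_forall fun _ => ENNReal.ofReal_lt_top)]
  simp [ENNReal.toReal_ofReal, Real.sqrt_nonneg]

end Measure

end

/-! ### Green's formula and chart-independence of the Laplacian. -/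

section

/-- Extended by zero, W becomes a C¹ function with compact support on the whole space, and the
integral of a directional derivative of such a function vanishes. -/
lemma integrable_and_integral_fderiv_eq_zero {V : Type*} [NormedAddCommGroup V] [NormedSpace ℝ V]
    [FiniteDimensional ℝ V] [MeasurableSpace V] [BorelSpace V] {μ : Measure V}
    [μ.IsAddHaarMeasure] {W : V → ℝ} {T K : Set V} (hT : IsOpen T) (hK : IsCompact K)
    (hKT : K ⊆ T) (hW : ContDiffOn ℝ 1 W T) (h0 : ∀ y ∈ T, y ∉ K → W y = 0) (v : V) :
    IntegrableOn (fun y => fderiv ℝ W y v) T μ ∧ ∫ y in T, fderiv ℝ W y v ∂μ = 0 := by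
  set W' := T.indicator W
  have heq : ∀ y ∈ T, W' =ᶠ[𝓝 y] W := fun y hy => by
    filter_upwards [hT.mem_nhds hy] with z hz using Set.indicator_of_mem hz W
  have hts : tsupport W' ⊆ K := by
    refine closure_minimal (fun y hy => ?_) hK.isClosed
    by_contra hyK
    refine hy ?_
    by_cases hyT : y ∈ T
    · simp [W', hyT, h0 y hyT hyK]
    · simp [W', hyT]
  have hsmooth : ContDiff ℝ 1 W' := by
    rw [contDiff_iff_contDiffAt]
    intro y
    by_cases hy : y ∈ tsupport W'
    · exact (hW.contDiffAt (hT.mem_nhds (hKT (hts hy)))).congr_of_eventuallyEq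
        (heq y (hKT (hts hy)))
    · exact (contDiffAt_const (c := (0 : ℝ))).congr_of_eventuallyEq
        (notMem_tsupport_iff_eventuallyEq.1 hy)
  have hcs : HasCompactSupport W' := hK.of_isClosed_subset (isClosed_tsupport _) hts
  have hcs' : HasCompactSupport (fun y => fderiv ℝ W' y v) := hcs.fderiv_apply ℝ v
  have hint : Integrable (fun y => fderiv ℝ W' y v) μ :=
    ((hsmooth.continuous_fderiv (by simp)).clm_apply continuous_const).integrable_of_hasCompactSupport
      hcs'
  have hfd : ∀ y ∈ T, fderiv ℝ W y v = fderiv ℝ W' y v := fun y hy => by rw [(heq y hy).fderiv_eq]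
  -- Integration by parts against the constant function 1.
  have hz : ∫ y, fderiv ℝ W' y v ∂μ = 0 := by
    have := integral_mul_fderiv_eq_neg_fderiv_mul_of_integrable (μ := μ) (f := fun _ : V => (1 : ℝ))
      (g := W') (v := v) (by simp) (by simpa using hint)
      (by simpa using hsmooth.continuous.integrable_of_hasCompactSupport hcs)
      (fun _ _ => differentiableAt_const _)
      (fun _ _ => (hsmooth.differentiable (by simp)).differentiableAt)
    simpa using this
  constructor
  · exact hint.integrableOn.congr_fun (fun y hy => (hfd y hy).symm) hT.measurableSet
  · rw [setIntegral_congr_fun hT.measurableSet hfd, setIntegral_eq_integral_of_forall_compl_eq_zero,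
      hz]
    intro y hy
    by_contra hne
    have : y ∈ tsupport W' := support_fderiv_subset ℝ (fun h => hne (by simp [h]))
    exact hy (hKT (hts this))

variable {d : ℕ} {M : Type*} [TopologicalSpace M] [ChartedSpace (EuclideanSpace ℝ (Fin d)) M]

lemma coordDeriv_eq_zero_of_notMem_tsupport {h : M → ℝ} {x : M} (hx : x ∉ tsupport h) (i : Fin d) :
    coordDeriv x h (extChartAt (𝓡 d) x x) i = 0 := by
  have h1 : h =ᶠ[𝓝 x] 0 := notMem_tsupport_iff_eventuallyEq.1 hx
  have h2 : Filter.Tendsto (extChartAt (𝓡 d) x).symm (𝓝 (extChartAt (𝓡 d) x x)) (𝓝 x) := by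
    have := continuousAt_extChartAt_symm (I := 𝓡 d) x
    simpa [ContinuousAt] using this
  have h3 : h ∘ (extChartAt (𝓡 d) x).symm =ᶠ[𝓝 (extChartAt (𝓡 d) x x)] fun _ => 0 :=
    h2.eventually h1
  rw [coordDeriv, h3.fderiv_eq]
  simp

variable [IsManifold (𝓡 d) ∞ M] (g : SmoothMetric d M)

/-- The Hodge Laplacian computed in the chart at `x₀`. -/
def chartLaplacian (x₀ : M) (f : M → ℝ) (p : M) : ℝ :=
  - coordDivergence (gram g x₀) (coordGrad g x₀ f) (extChartAt (𝓡 d) x₀ p)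

lemma continuousOn_chartLaplacian {f : M → ℝ} (hf : ContMDiff (𝓡 d) 𝓘(ℝ, ℝ) ∞ f) (x₀ : M) :
    ContinuousOn (chartLaplacian g x₀ f) (extChartAt (𝓡 d) x₀).source :=
  ((contDiffOn_coordDivergence g hf x₀).continuousOn.comp (continuousOn_extChartAt x₀)
    fun _ hp => (extChartAt (𝓡 d) x₀).map_source hp).neg

lemma innerDiff_eq_zero_of_notMem_tsupport {h : M → ℝ} {x : M} (hx : x ∉ tsupport h)
    (f : M → ℝ) : innerDiff g h f x = 0 := by
  unfold innerDiff coordInner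
  exact Finset.sum_eq_zero fun i _ => by rw [coordDeriv_eq_zero_of_notMem_tsupport hx, zero_mul]

lemma continuous_mul_of_tsupport_subset {X : Type*} [TopologicalSpace X] {h u : X → ℝ} {U : Set X}
    (hU : IsOpen U) (hh : Continuous h) (hs : tsupport h ⊆ U) (hu : ContinuousOn u U) :
    Continuous fun x => h x * u x :=
  continuous_of_tsupport fun _ hx => hh.continuousAt.mul (hu.continuousAt
    (hU.mem_nhds (hs (tsupport_mul_subset_left hx))))

variable [CompactSpace M] [MeasurableSpace M] [BorelSpace M]

lemma _root_.Continuous.integrable_riemVolume {w : M → ℝ} (hw : Continuous w) :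
    Integrable w (riemVolume g) :=
  hw.integrable_of_hasCompactSupport (HasCompactSupport.of_compactSpace w)

/-- The density √det g cancels the (det g)^(-1/2) of the divergence, so by the Leibniz rule the
difference of the two integrands is, in coordinates, minus the Euclidean divergence of √det g · h ·
grad f. This field has compact support in the chart. -/
lemma integral_mul_chartLaplacian {f h : M → ℝ} (hf : ContMDiff (𝓡 d) 𝓘(ℝ, ℝ) ∞ f)
    (hh : ContMDiff (𝓡 d) 𝓘(ℝ, ℝ) ∞ h) {x₀ : M}
    (hs : tsupport h ⊆ (extChartAt (𝓡 d) x₀).source) :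
    ∫ x, h x * chartLaplacian g x₀ f x ∂(riemVolume g) =
      ∫ x, innerDiff g h f x ∂(riemVolume g) := by
  have hc1 := continuous_mul_of_tsupport_subset (isOpen_extChartAt_source x₀) hh.continuous hs
    (continuousOn_chartLaplacian g hf x₀)
  have hc2 := continuous_innerDiff g hh hf
  rw [← sub_eq_zero, ← integral_sub (hc1.integrable_riemVolume g) (hc2.integrable_riemVolume g),
    integral_riemVolume_eq g x₀
      (w := fun x => h x * chartLaplacian g x₀ f x - innerDiff g h f x) (hc1.sub hc2)]
  swap
  · intro p hp
    by_contra hpU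
    have : p ∉ tsupport h := fun h => hpU (hs h)
    refine hp ?_
    simp [image_eq_zero_of_notMem_tsupport this, innerDiff_eq_zero_of_notMem_tsupport g this]
  have hT := isOpen_extChartAt_target (I := 𝓡 d) x₀
  set T := (extChartAt (𝓡 d) x₀).target
  set P : Fin d → EuclideanSpace ℝ (Fin d) → ℝ :=
    fun i y => √(gram g x₀ y).det * coordGrad g x₀ f y i with hP
  set k := h ∘ (extChartAt (𝓡 d) x₀).symm with hk
  have hPs (i : Fin d) : ContDiffOn ℝ ∞ (P i) T :=
    (contDiffOn_sqrt_det_gram g x₀).mul (contDiffOn_coordGrad g hf x₀ i)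
  have hks : ContDiffOn ℝ ∞ k T := contDiffOn_comp_symm hh x₀
  have hKc : IsCompact (extChartAt (𝓡 d) x₀ '' tsupport h) :=
    (isClosed_tsupport h).isCompact.image_of_continuousOn ((continuousOn_extChartAt x₀).mono hs)
  have hKT : extChartAt (𝓡 d) x₀ '' tsupport h ⊆ T := by
    rintro _ ⟨p, hp, rfl⟩
    exact (extChartAt (𝓡 d) x₀).map_source (hs hp)
  have hmain (i : Fin d) := integrable_and_integral_fderiv_eq_zero
    (μ := (volume : Measure (EuclideanSpace ℝ (Fin d)))) hT hKc hKT
    (((hPs i).mul hks).of_le (by simp)) (fun y hy hyK => by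
      have : (extChartAt (𝓡 d) x₀).symm y ∉ tsupport h := fun hm =>
        hyK ⟨_, hm, (extChartAt (𝓡 d) x₀).right_inv hy⟩
      change P i y * h ((extChartAt (𝓡 d) x₀).symm y) = 0
      rw [image_eq_zero_of_notMem_tsupport this, mul_zero]) (e i)
  have hpt : ∀ y ∈ T, √(gram g x₀ y).det *
      (h ((extChartAt (𝓡 d) x₀).symm y) * chartLaplacian g x₀ f ((extChartAt (𝓡 d) x₀).symm y) -
        innerDiff g h f ((extChartAt (𝓡 d) x₀).symm y)) =
      - ∑ i, fderiv ℝ (fun y => P i y * k y) y (e i) := by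
    intro y hy
    have hdet : √(gram g x₀ y).det ≠ 0 := (Real.sqrt_pos.2 (gram_det_pos g hy)).ne'
    have hprod (i : Fin d) : fderiv ℝ (fun y => P i y * k y) y (e i) =
        P i y * coordDeriv x₀ h y i + k y * fderiv ℝ (P i) y (e i) := by
      rw [fderiv_fun_mul (((hPs i).contDiffAt (hT.mem_nhds hy)).differentiableAt (by simp))
        ((hks.contDiffAt (hT.mem_nhds hy)).differentiableAt (by simp))]
      simp [coordDeriv, hk]
    rw [innerDiff_symm_eq g hh hf hy, chartLaplacian, (extChartAt (𝓡 d) x₀).right_inv hy,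
      coordDivergence, coordInner, Finset.sum_congr rfl fun i _ => hprod i, Finset.sum_add_distrib,
      ← Finset.mul_sum]
    change _ * (k y * -(_ * ∑ i, fderiv ℝ (P i) y (e i)) - _) = _
    have : ∑ i, P i y * coordDeriv x₀ h y i =
        √(gram g x₀ y).det * ∑ i, coordDeriv x₀ h y i * coordGrad g x₀ f y i := by
      rw [Finset.mul_sum]
      exact Finset.sum_congr rfl fun i _ => by simp only [hP]; ring
    rw [this]
    field_simp
    ring
  rw [setIntegral_congr_fun hT.measurableSet hpt, integral_neg,
    integral_finsetSum _ fun i _ => (hmain i).1]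
  simp only [fun i => (hmain i).2, Finset.sum_const_zero, neg_zero]

variable [T2Space M]

/-- Tested against smooth functions supported in the overlap, both sides give ∫ ⟨dh, df⟩. They
therefore agree almost everywhere there, and everywhere by continuity, without transforming second
derivatives. -/
lemma chartLaplacian_eq {f : M → ℝ} (hf : ContMDiff (𝓡 d) 𝓘(ℝ, ℝ) ∞ f) (x₀ x₁ : M) :
    Set.EqOn (chartLaplacian g x₀ f) (chartLaplacian g x₁ f)
      ((extChartAt (𝓡 d) x₀).source ∩ (extChartAt (𝓡 d) x₁).source) := by
  have hO := (isOpen_extChartAt_source (I := 𝓡 d) x₀).inter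
    (isOpen_extChartAt_source (I := 𝓡 d) x₁)
  set O := (extChartAt (𝓡 d) x₀).source ∩ (extChartAt (𝓡 d) x₁).source
  have hc0 := (continuousOn_chartLaplacian g hf x₀).mono (Set.inter_subset_left :
    O ⊆ (extChartAt (𝓡 d) x₀).source)
  have hc1 := (continuousOn_chartLaplacian g hf x₁).mono (Set.inter_subset_right :
    O ⊆ (extChartAt (𝓡 d) x₁).source)
  have : SecondCountableTopology M :=
    ChartedSpace.secondCountable_of_sigmaCompact (EuclideanSpace ℝ (Fin d)) M
  have hae := hO.ae_eq_zero_of_integral_contMDiff_smul_eq_zero (𝓡 d) (μ := riemVolume g)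
    (f := fun x => chartLaplacian g x₀ f x - chartLaplacian g x₁ f x)
    ((hc0.sub hc1).locallyIntegrableOn hO.measurableSet) (fun h hh _ hs => by
      have hs0 := hs.trans Set.inter_subset_left
      have hs1 := hs.trans Set.inter_subset_right
      have e0 := integral_mul_chartLaplacian g hf hh hs0
      have e1 := integral_mul_chartLaplacian g hf hh hs1
      simp only [smul_eq_mul, mul_sub]
      rw [integral_sub, e0, e1, sub_self]
      · exact (continuous_mul_of_tsupport_subset (isOpen_extChartAt_source x₀) hh.continuous hs0
          (continuousOn_chartLaplacian g hf x₀)).integrable_riemVolume g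
      · exact (continuous_mul_of_tsupport_subset (isOpen_extChartAt_source x₁) hh.continuous hs1
          (continuousOn_chartLaplacian g hf x₁)).integrable_riemVolume g)
  refine Measure.eqOn_open_of_ae_eq (μ := riemVolume g) ?_ hO hc0 hc1
  rw [Filter.EventuallyEq, ae_restrict_iff' hO.measurableSet]
  filter_upwards [hae] with x hx hxO using sub_eq_zero.1 (hx hxO)

lemma hodgeLaplacian_eq {f : M → ℝ} (hf : ContMDiff (𝓡 d) 𝓘(ℝ, ℝ) ∞ f) {x₀ p : M}
    (hp : p ∈ (extChartAt (𝓡 d) x₀).source) : hodgeLaplacian g f p = chartLaplacian g x₀ f p :=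
  chartLaplacian_eq g hf p x₀ ⟨mem_extChartAt_source p, hp⟩

omit [MeasurableSpace M] [BorelSpace M] in
lemma continuous_hodgeLaplacian {f : M → ℝ} (hf : ContMDiff (𝓡 d) 𝓘(ℝ, ℝ) ∞ f) :
    Continuous (hodgeLaplacian g f) := by
  -- The statement involves no measure, but chart-independence of the Laplacian is proved by
  -- integration.
  borelize M
  rw [continuous_iff_continuousAt]
  intro x
  refine ((continuousOn_chartLaplacian g hf x).continuousAt
    (extChartAt_source_mem_nhds x)).congr ?_
  filter_upwards [extChartAt_source_mem_nhds (I := 𝓡 d) x] with p hp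
    using (hodgeLaplacian_eq g hf hp).symm

lemma integral_mul_hodgeLaplacian_of_tsupport_subset {f h : M → ℝ}
    (hf : ContMDiff (𝓡 d) 𝓘(ℝ, ℝ) ∞ f) (hh : ContMDiff (𝓡 d) 𝓘(ℝ, ℝ) ∞ h) {x₀ : M}
    (hs : tsupport h ⊆ (extChartAt (𝓡 d) x₀).source) :
    ∫ x, h x * hodgeLaplacian g f x ∂(riemVolume g) =
      ∫ x, innerDiff g h f x ∂(riemVolume g) := by
  rw [← integral_mul_chartLaplacian g hf hh hs]
  congr 1
  ext x
  by_cases hx : x ∈ tsupport h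
  · rw [hodgeLaplacian_eq g hf (hs hx)]
  · simp [image_eq_zero_of_notMem_tsupport hx]

omit [CompactSpace M] [T2Space M] [MeasurableSpace M] [BorelSpace M] in
lemma innerDiff_finset_sum {ι : Type*} (s : Finset ι) {u : ι → M → ℝ}
    (hu : ∀ i ∈ s, ContMDiff (𝓡 d) 𝓘(ℝ, ℝ) ∞ (u i)) (f : M → ℝ) (x : M) :
    innerDiff g (fun x => ∑ i ∈ s, u i x) f x = ∑ i ∈ s, innerDiff g (u i) f x := by
  have h1 (j : Fin d) : coordDeriv x (fun x => ∑ i ∈ s, u i x) (extChartAt (𝓡 d) x x) j =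
      ∑ i ∈ s, coordDeriv x (u i) (extChartAt (𝓡 d) x x) j := by
    simp only [coordDeriv]
    have := fderiv_fun_sum fun i hi => differentiableAt_comp_symm (hu i hi)
      (mem_extChartAt_target (I := 𝓡 d) x)
    have h2 : (fun x => ∑ i ∈ s, u i x) ∘ (extChartAt (𝓡 d) x).symm =
      fun y => ∑ i ∈ s, (u i ∘ (extChartAt (𝓡 d) x).symm) y := rfl
    rw [h2, this]
    simp
  simp only [innerDiff, coordInner, h1, Finset.sum_mul]
  exact Finset.sum_comm

/-- Green's formula on a compact Riemannian manifold. -/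
theorem integral_mul_hodgeLaplacian {f h : M → ℝ}
    (hf : ContMDiff (𝓡 d) 𝓘(ℝ, ℝ) ∞ f) (hh : ContMDiff (𝓡 d) 𝓘(ℝ, ℝ) ∞ h) :
    ∫ x, h x * hodgeLaplacian g f x ∂(riemVolume g) =
      ∫ x, innerDiff g h f x ∂(riemVolume g) := by
  -- A partition of unity subordinate to the charts, with finitely many nonzero members by
  -- compactness, reduces to h supported in one chart.
  obtain ⟨ρ, hρ⟩ := SmoothPartitionOfUnity.exists_isSubordinate_chartAt_source (𝓡 d) M
  have hfin : (Set.ofPred fun i => (Function.support (ρ i)).Nonempty).Finite :=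
    ρ.locallyFinite.finite_nonempty_of_compact
  set s := hfin.toFinset
  have hone (x : M) : ∑ i ∈ s, ρ i x = 1 := by
    rw [← ρ.sum_eq_one (Set.mem_univ x)]
    refine (finsum_eq_sum_of_support_subset _ fun i hi => ?_).symm
    exact hfin.mem_toFinset.2 ⟨x, hi⟩
  set u : M → M → ℝ := fun i x => ρ i x * h x with hu
  have hus (i : M) : ContMDiff (𝓡 d) 𝓘(ℝ, ℝ) ∞ (u i) := (ρ i).contMDiff.mul hh
  have hsum : h = fun x => ∑ i ∈ s, u i x := by
    ext x
    simp only [hu]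
    rw [← Finset.sum_mul, hone, one_mul]
  have hts (i : M) : tsupport (u i) ⊆ (extChartAt (𝓡 d) i).source := by
    rw [extChartAt_source]
    exact (tsupport_mul_subset_left).trans (hρ i)
  have hL : ∫ x, h x * hodgeLaplacian g f x ∂(riemVolume g) =
      ∑ i ∈ s, ∫ x, u i x * hodgeLaplacian g f x ∂(riemVolume g) := by
    rw [← integral_finsetSum]
    · congr 1
      ext x
      rw [← Finset.sum_mul, ← congrFun hsum x]
    · exact fun i _ =>
        ((hus i).continuous.mul (continuous_hodgeLaplacian g hf)).integrable_riemVolume g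
  have hR : ∫ x, innerDiff g h f x ∂(riemVolume g) =
      ∑ i ∈ s, ∫ x, innerDiff g (u i) f x ∂(riemVolume g) := by
    rw [← integral_finsetSum]
    · congr 1
      ext x
      conv_lhs => rw [hsum]
      exact innerDiff_finset_sum g s (fun i _ => hus i) f x
    · exact fun i _ => (continuous_innerDiff g (hus i) hf).integrable_riemVolume g
  rw [hL, hR]
  exact Finset.sum_congr rfl fun i _ =>
    integral_mul_hodgeLaplacian_of_tsupport_subset g hf (hus i) (hts i)

end

/-! ### Differentiating smooth families in the parameter. -/

section

lemma _root_.HasFDerivAt.hasDerivAt_slice_left {V W : Type*} [NormedAddCommGroup V]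
    [NormedSpace ℝ V] [NormedAddCommGroup W] [NormedSpace ℝ W] {u : ℝ × V → W}
    {u' : ℝ × V →L[ℝ] W} {t : ℝ} {y : V} (hu : HasFDerivAt u u' (t, y)) :
    HasDerivAt (fun s => u (s, y)) (u' (1, 0)) t := by
  have := HasFDerivAt.comp (f := fun s : ℝ => (s, y)) t hu (hasFDerivAt_prodMk_left t y)
  simpa [Function.comp_def] using this.hasDerivAt

lemma _root_.HasFDerivAt.fderiv_slice_right {V W : Type*} [NormedAddCommGroup V]
    [NormedSpace ℝ V] [NormedAddCommGroup W] [NormedSpace ℝ W] {u : ℝ × V → W}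
    {u' : ℝ × V →L[ℝ] W} {t : ℝ} {y : V} (hu : HasFDerivAt u u' (t, y)) (v : V) :
    fderiv ℝ (fun z => u (t, z)) y v = u' (0, v) := by
  have := HasFDerivAt.comp (f := fun z : V => (t, z)) y hu (hasFDerivAt_prodMk_right t y)
  rw [show (fun z => u (t, z)) = u ∘ fun z => (t, z) from rfl, this.fderiv]
  simp

/-- Partial derivatives in the two factors of `ℝ × V` commute. -/
lemma hasDerivAt_fderiv_slice {V : Type*} [NormedAddCommGroup V] [NormedSpace ℝ V]
    {u : ℝ × V → ℝ} {S : Set (ℝ × V)} (hS : IsOpen S) (hu : ContDiffOn ℝ ∞ u S) {t : ℝ} {y : V}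
    (h : (t, y) ∈ S) (v : V) :
    HasDerivAt (fun s => fderiv ℝ (fun z => u (s, z)) y v)
      (fderiv ℝ (fun z => deriv (fun s => u (s, z)) t) y v) t := by
  have hd {q : ℝ × V} (hq : q ∈ S) : HasFDerivAt u (fderiv ℝ u q) q :=
    ((hu.contDiffAt (hS.mem_nhds hq)).differentiableAt (by simp)).hasFDerivAt
  have hu2 : HasFDerivAt (fderiv ℝ u) (fderiv ℝ (fderiv ℝ u) (t, y)) (t, y) :=
    (((hu.fderiv_of_isOpen (m := ∞) hS (by simp)).contDiffAt (hS.mem_nhds h)).differentiableAt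
      (by simp)).hasFDerivAt
  have hsymm : IsSymmSndFDerivAt ℝ u (t, y) :=
    (hu.contDiffAt (hS.mem_nhds h)).isSymmSndFDerivAt (by simp [ENat.LEInfty.out])
  have hv (w : ℝ × V) : HasFDerivAt (fun q => fderiv ℝ u q w)
      ((fderiv ℝ (fderiv ℝ u) (t, y)).flip w) (t, y) := by
    have := hu2.clm_apply (hasFDerivAt_const w (t, y))
    simpa using this
  have hnt : ∀ᶠ s in 𝓝 t, (s, y) ∈ S :=
    (Continuous.prodMk_left y).continuousAt.preimage_mem_nhds (hS.mem_nhds h)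
  have hny : ∀ᶠ z in 𝓝 y, (t, z) ∈ S :=
    (Continuous.prodMk_right t).continuousAt.preimage_mem_nhds (hS.mem_nhds h)
  have e1 : (fun s => fderiv ℝ (fun z => u (s, z)) y v) =ᶠ[𝓝 t]
      fun s => fderiv ℝ u (s, y) (0, v) := by
    filter_upwards [hnt] with s hs using (hd hs).fderiv_slice_right v
  have e2 : (fun z => deriv (fun s => u (s, z)) t) =ᶠ[𝓝 y] fun z => fderiv ℝ u (t, z) (1, 0) := by
    filter_upwards [hny] with z hz using (hd hz).hasDerivAt_slice_left.deriv
  rw [e2.fderiv_eq, (hv (1, 0)).fderiv_slice_right v]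
  refine HasDerivAt.congr_of_eventuallyEq ?_ e1
  convert (hv (0, v)).hasDerivAt_slice_left using 1
  simp only [ContinuousLinearMap.flip_apply]
  exact hsymm _ _

/-- Differentiation under the integral sign for jointly continuous data on a compact space. -/
lemma hasDerivAt_integral_of_continuousOn {X : Type*} [TopologicalSpace X] [CompactSpace X]
    [MeasurableSpace X] [BorelSpace X] {μ : Measure X} [IsFiniteMeasure μ] {W W' : ℝ → X → ℝ}
    {J : Set ℝ} (hJ : IsOpen J) (hW : ∀ t ∈ J, Continuous (W t))
    (hW' : ContinuousOn (fun p : ℝ × X => W' p.1 p.2) (J ×ˢ Set.univ))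
    (hd : ∀ t ∈ J, ∀ x, HasDerivAt (fun s => W s x) (W' t x) t) {t₀ : ℝ} (ht₀ : t₀ ∈ J) :
    HasDerivAt (fun t => ∫ x, W t x ∂μ) (∫ x, W' t₀ x ∂μ) t₀ := by
  -- On K × X, with K a compact neighbourhood of t₀ in J, the parameter derivative is bounded; this
  -- constant is the dominating function.
  obtain ⟨K, hK, hKJ, hKc⟩ := local_compact_nhds (hJ.mem_nhds ht₀)
  have hslice : Continuous (W' t₀) := by
    rw [← continuousOn_univ]
    exact hW'.comp (Continuous.prodMk_right t₀).continuousOn fun x _ => ⟨ht₀, Set.mem_univ x⟩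
  obtain ⟨C, hC⟩ := (hKc.prod (isCompact_univ (X := X))).exists_bound_of_continuousOn
    (hW'.mono (Set.prod_mono hKJ subset_rfl))
  refine (hasDerivAt_integral_of_dominated_loc_of_deriv_le (bound := fun _ => C) hK ?_ ?_ ?_
    ?_ (integrable_const C) ?_).2
  · filter_upwards [hJ.mem_nhds ht₀] with t ht using (hW t ht).measurable.aestronglyMeasurable
  · exact (hW t₀ ht₀).integrable_of_hasCompactSupport (HasCompactSupport.of_compactSpace _)
  · exact hslice.measurable.aestronglyMeasurable
  · exact Filter.Eventually.of_forall fun x t ht => hC (t, x) ⟨ht, Set.mem_univ x⟩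
  · exact Filter.Eventually.of_forall fun x t ht => hd t (hKJ ht) x

variable {d : ℕ} {M : Type*} [TopologicalSpace M] [ChartedSpace (EuclideanSpace ℝ (Fin d)) M]

/-- Joint smoothness of a family of functions on a manifold, expressed in charts. -/
def IsSmoothFamily (d : ℕ) {M : Type*} [TopologicalSpace M]
    [ChartedSpace (EuclideanSpace ℝ (Fin d)) M] (J : Set ℝ) (F : ℝ → M → ℝ) : Prop :=
  ∀ x₀ : M, ContDiffOn ℝ ∞
    (fun p : ℝ × EuclideanSpace ℝ (Fin d) => F p.1 ((extChartAt (𝓡 d) x₀).symm p.2))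
    (J ×ˢ (extChartAt (𝓡 d) x₀).target)

lemma continuousOn_of_charts {J : Set ℝ} (hJ : IsOpen J) {W : ℝ → M → ℝ}
    (h : ∀ x₀ : M, ContinuousOn
      (fun p : ℝ × EuclideanSpace ℝ (Fin d) => W p.1 ((extChartAt (𝓡 d) x₀).symm p.2))
      (J ×ˢ (extChartAt (𝓡 d) x₀).target)) :
    ContinuousOn (fun p : ℝ × M => W p.1 p.2) (J ×ˢ Set.univ) := by
  rintro ⟨t, x⟩ ⟨ht, -⟩
  have hmap : ContinuousAt (fun p : ℝ × M => (p.1, extChartAt (𝓡 d) x p.2)) (t, x) :=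
    continuousAt_fst.prodMk (ContinuousAt.comp (x := (t, x)) (f := Prod.snd)
      (continuousAt_extChartAt x) continuousAt_snd)
  have hW := (h x).continuousAt (x := (t, extChartAt (𝓡 d) x x))
    (prod_mem_nhds (hJ.mem_nhds ht) (extChartAt_target_mem_nhds x))
  have hcomp := ContinuousAt.comp (x := (t, x))
    (f := fun p : ℝ × M => (p.1, extChartAt (𝓡 d) x p.2)) hW hmap
  refine (hcomp.congr ?_).continuousWithinAt
  filter_upwards [continuousAt_snd.preimage_mem_nhds (extChartAt_source_mem_nhds (I := 𝓡 d) x)]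
    with p hp
  rw [Function.comp_apply, (extChartAt (𝓡 d) x).left_inv hp]

namespace IsSmoothFamily

variable {J : Set ℝ} {F H : ℝ → M → ℝ}

lemma isOpen_domain (hJ : IsOpen J) (x₀ : M) :
    IsOpen (J ×ˢ (extChartAt (𝓡 d) x₀).target : Set (ℝ × EuclideanSpace ℝ (Fin d))) :=
  hJ.prod (isOpen_extChartAt_target x₀)

lemma hasFDerivAt (hF : IsSmoothFamily d J F) (hJ : IsOpen J) {x₀ : M} {t : ℝ} (ht : t ∈ J)
    {y : EuclideanSpace ℝ (Fin d)} (hy : y ∈ (extChartAt (𝓡 d) x₀).target) :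
    HasFDerivAt (fun p : ℝ × EuclideanSpace ℝ (Fin d) => F p.1 ((extChartAt (𝓡 d) x₀).symm p.2))
      (fderiv ℝ (fun p : ℝ × EuclideanSpace ℝ (Fin d) =>
        F p.1 ((extChartAt (𝓡 d) x₀).symm p.2)) (t, y)) (t, y) :=
  (((hF x₀).contDiffAt ((isOpen_domain hJ x₀).mem_nhds ⟨ht, hy⟩)).differentiableAt
    (by simp)).hasFDerivAt

lemma continuousOn (hF : IsSmoothFamily d J F) (hJ : IsOpen J) :
    ContinuousOn (fun p : ℝ × M => F p.1 p.2) (J ×ˢ Set.univ) :=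
  continuousOn_of_charts (d := d) hJ fun x₀ => (hF x₀).continuousOn

lemma timeDeriv (hF : IsSmoothFamily d J F) (hJ : IsOpen J) :
    IsSmoothFamily d J (fun t x => deriv (fun s => F s x) t) := fun x₀ =>
  (contDiffOn_fderiv_apply (isOpen_domain hJ x₀) (hF x₀) (1, 0)).congr fun _ hp =>
    (hF.hasFDerivAt hJ hp.1 hp.2).hasDerivAt_slice_left.deriv

lemma hasDerivAt (hF : IsSmoothFamily d J F) (hJ : IsOpen J) {t : ℝ} (ht : t ∈ J) (x : M) :
    HasDerivAt (fun s => F s x) (deriv (fun s => F s x) t) t := by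
  have := (hF.hasFDerivAt hJ (x₀ := x) ht (mem_extChartAt_target x)).hasDerivAt_slice_left
  simp only [extChartAt_to_inv] at this
  exact this.differentiableAt.hasDerivAt

lemma contDiffOn_coordDeriv (hF : IsSmoothFamily d J F) (hJ : IsOpen J) (x₀ : M) (i : Fin d) :
    ContDiffOn ℝ ∞ (fun p : ℝ × EuclideanSpace ℝ (Fin d) => coordDeriv x₀ (F p.1) p.2 i)
      (J ×ˢ (extChartAt (𝓡 d) x₀).target) :=
  (contDiffOn_fderiv_apply (isOpen_domain hJ x₀) (hF x₀) (0, e i)).congr fun _ hp =>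
    (hF.hasFDerivAt hJ hp.1 hp.2).fderiv_slice_right (e i)

lemma hasDerivAt_coordDeriv (hF : IsSmoothFamily d J F) (hJ : IsOpen J) {x₀ : M} {t : ℝ}
    (ht : t ∈ J) {y : EuclideanSpace ℝ (Fin d)} (hy : y ∈ (extChartAt (𝓡 d) x₀).target)
    (i : Fin d) :
    HasDerivAt (fun s => coordDeriv x₀ (F s) y i)
      (coordDeriv x₀ (fun x => deriv (fun s => F s x) t) y i) t :=
  hasDerivAt_fderiv_slice (isOpen_domain hJ x₀) (hF x₀) ⟨ht, hy⟩ (e i)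

lemma contMDiff (hF : IsSmoothFamily d J F) {t : ℝ} (ht : t ∈ J) :
    ContMDiff (𝓡 d) 𝓘(ℝ, ℝ) ∞ (F t) := by
  intro x
  have h1 : ContDiffOn ℝ ∞ (fun y => F t ((extChartAt (𝓡 d) x).symm y))
      (extChartAt (𝓡 d) x).target :=
    (hF x).comp (contDiff_prodMk_right t).contDiffOn fun y hy => ⟨ht, hy⟩
  have h2 := (h1.contDiffAt (extChartAt_target_mem_nhds x)).contMDiffAt.comp x
    (contMDiffAt_extChartAt (I := 𝓡 d) (n := ∞))
  refine h2.congr_of_eventuallyEq ?_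
  filter_upwards [extChartAt_source_mem_nhds (I := 𝓡 d) x] with p hp
  rw [Function.comp_apply, (extChartAt (𝓡 d) x).left_inv hp]

variable [IsManifold (𝓡 d) ∞ M] (g : SmoothMetric d M)

lemma of_contMDiffOn (hF : ContMDiffOn (𝓘(ℝ, ℝ).prod (𝓡 d)) 𝓘(ℝ, ℝ) ∞
    (fun p : ℝ × M => F p.1 p.2) (J ×ˢ Set.univ)) : IsSmoothFamily d J F := by
  intro x₀
  have h1 : ContMDiffOn 𝓘(ℝ, ℝ × EuclideanSpace ℝ (Fin d)) (𝓘(ℝ, ℝ).prod (𝓡 d)) ∞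
      (fun p : ℝ × EuclideanSpace ℝ (Fin d) => (p.1, (extChartAt (𝓡 d) x₀).symm p.2))
      (J ×ˢ (extChartAt (𝓡 d) x₀).target) :=
    (contDiff_fst.contMDiff.contMDiffOn).prodMk
      ((contMDiffOn_extChartAt_symm x₀).comp contDiff_snd.contMDiff.contMDiffOn fun p hp => hp.2)
  rw [← contMDiffOn_iff_contDiffOn]
  exact hF.comp h1 fun p hp => ⟨hp.1, Set.mem_univ _⟩

lemma continuousOn_innerDiff (hF : IsSmoothFamily d J F) (hH : IsSmoothFamily d J H)
    (hJ : IsOpen J) :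
    ContinuousOn (fun p : ℝ × M => innerDiff g (F p.1) (H p.1) p.2) (J ×ˢ Set.univ) := by
  refine continuousOn_of_charts (d := d) (W := fun t x => innerDiff g (F t) (H t) x) hJ
    fun x₀ => ?_
  have h1 : ContinuousOn (fun p : ℝ × EuclideanSpace ℝ (Fin d) =>
      coordInner g x₀ (F p.1) (H p.1) p.2) (J ×ˢ (extChartAt (𝓡 d) x₀).target) := by
    unfold coordInner coordGrad
    refine continuousOn_finsetSum _ fun i _ =>
      (hF.contDiffOn_coordDeriv hJ x₀ i).continuousOn.mul (continuousOn_finsetSum _ fun j _ => ?_)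
    exact ((contDiffOn_gram_inv g x₀ i j).continuousOn.comp continuousOn_snd fun p hp => hp.2).mul
      (hH.contDiffOn_coordDeriv hJ x₀ j).continuousOn
  exact h1.congr fun p hp => innerDiff_symm_eq g (hF.contMDiff hp.1) (hH.contMDiff hp.1) hp.2

lemma hasDerivAt_innerDiff_self (hF : IsSmoothFamily d J F) (hJ : IsOpen J) {t : ℝ} (ht : t ∈ J)
    (x : M) :
    HasDerivAt (fun s => innerDiff g (F s) (F s) x)
      (2 * innerDiff g (fun x => deriv (fun s => F s x) t) (F t) x) t := by
  have hy := mem_extChartAt_target (I := 𝓡 d) x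
  set y := extChartAt (𝓡 d) x x with hydef
  have h1 : HasDerivAt (fun s => ∑ i, coordDeriv x (F s) y i *
      ∑ j, (gram g x y)⁻¹ i j * coordDeriv x (F s) y j) _ t :=
    HasDerivAt.fun_sum fun i _ => (hF.hasDerivAt_coordDeriv hJ ht hy i).mul
      (HasDerivAt.fun_sum fun j _ => (hF.hasDerivAt_coordDeriv hJ ht hy j).const_mul _)
  refine h1.congr_deriv ?_
  rw [Finset.sum_add_distrib, two_mul]
  congr 1
  simp only [Finset.mul_sum]
  unfold innerDiff coordInner coordGrad
  simp only [Finset.mul_sum]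
  -- The remaining term of the product rule has the parameter derivative in the gradient factor;
  -- symmetry of the inverse metric identifies it with the other one.
  rw [Finset.sum_comm]
  refine Finset.sum_congr rfl fun i _ => Finset.sum_congr rfl fun j _ => ?_
  have hsym : (gram g x y)⁻¹ j i = (gram g x y)⁻¹ i j := by
    simpa using (gram_posDef g hy).inv.isHermitian.apply i j
  rw [hsym]
  ring

end IsSmoothFamily

end

/-! ### First variation of the total modified scalar curvature, the volume and `EH`. -/

section

variable {d : ℕ} {M : Type*} [TopologicalSpace M] [ChartedSpace (EuclideanSpace ℝ (Fin d)) M]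

lemma contMDiff_rpow {f : M → ℝ} (hf : ContMDiff (𝓡 d) 𝓘(ℝ, ℝ) ∞ f) (hpos : ∀ x, 0 < f x)
    (q : ℝ) : ContMDiff (𝓡 d) 𝓘(ℝ, ℝ) ∞ (fun x => f x ^ q) := fun x =>
  (Real.contDiffAt_rpow_const_of_ne (hpos x).ne').contMDiffAt.comp x (hf x)

variable [IsManifold (𝓡 d) ∞ M] (g : SmoothMetric d M)

lemma innerDiff_rpow_mul {f h : M → ℝ} (hf : ContMDiff (𝓡 d) 𝓘(ℝ, ℝ) ∞ f)
    (hpos : ∀ x, 0 < f x) (hh : ContMDiff (𝓡 d) 𝓘(ℝ, ℝ) ∞ h) (q : ℝ) (x : M) :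
    innerDiff g (fun x => f x ^ q * h x) f x =
      f x ^ q * innerDiff g h f x + q * f x ^ (q - 1) * h x * normDiffSq g f x := by
  have hy := mem_extChartAt_target (I := 𝓡 d) x
  have hx : (extChartAt (𝓡 d) x).symm (extChartAt (𝓡 d) x x) = x := extChartAt_to_inv x
  have h1 (i : Fin d) : coordDeriv x (fun x => f x ^ q * h x) (extChartAt (𝓡 d) x x) i =
      f x ^ q * coordDeriv x h (extChartAt (𝓡 d) x x) i +
        q * f x ^ (q - 1) * h x * coordDeriv x f (extChartAt (𝓡 d) x x) i := by
    have hf' := (differentiableAt_comp_symm hf hy).hasFDerivAt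
    have hh' := (differentiableAt_comp_symm hh hy).hasFDerivAt
    have hne : (f ∘ (extChartAt (𝓡 d) x).symm) (extChartAt (𝓡 d) x x) ≠ 0 := (hpos _).ne'
    have := ((hf'.rpow_const (p := q) (Or.inl hne)).mul hh').fderiv
    simp only [coordDeriv]
    have h2 : (fun x => f x ^ q * h x) ∘ (extChartAt (𝓡 d) x).symm =
      (fun y => (f ∘ (extChartAt (𝓡 d) x).symm) y ^ q) * (h ∘ (extChartAt (𝓡 d) x).symm) := rfl
    rw [h2, this]
    simp only [Function.comp_apply, hx, add_apply, smul_apply, smul_eq_mul]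
    ring
  unfold normDiffSq innerDiff coordInner
  simp only [h1, add_mul, Finset.sum_add_distrib, Finset.mul_sum]
  congr 1 <;> exact Finset.sum_congr rfl fun i _ => by ring

lemma innerDiff_const_left (c : ℝ) (f : M → ℝ) (x : M) : innerDiff g (fun _ => c) f x = 0 := by
  unfold innerDiff coordInner coordDeriv
  refine Finset.sum_eq_zero fun i _ => ?_
  have : (fun _ : M => c) ∘ (extChartAt (𝓡 d) x).symm = fun _ => c := rfl
  rw [this]
  simp

variable [CompactSpace M] [T2Space M]

lemma continuous_modScalar {f φ : M → ℝ} (hf : ContMDiff (𝓡 d) 𝓘(ℝ, ℝ) ∞ f)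
    (hpos : ∀ x, 0 < f x) (hφ : Continuous φ) (n k : ℝ) :
    Continuous (modScalar g f k n φ) := by
  have h1 := (contMDiff_rpow hf hpos (-k)).continuous
  have h2 := continuous_hodgeLaplacian g hf
  have h3 : Continuous (normDiffSq g f) := continuous_innerDiff g hf hf
  have h4 := hf.continuous
  have h5 (x : M) : f x ≠ 0 := (hpos x).ne'
  have h6 (x : M) : f x ^ 2 ≠ 0 := pow_ne_zero _ (h5 x)
  unfold modScalar
  exact h1.mul ((hφ.add ((continuous_const.mul (continuous_const.div h4 h5)).mul h2)).add
    ((continuous_const.mul (continuous_const.div (h4.pow 2) h6)).mul h3))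

variable [MeasurableSpace M] [BorelSpace M]

/-- Green's formula with weight `f ^ q`. -/
lemma integral_rpow_mul_innerDiff {f h : M → ℝ} (hf : ContMDiff (𝓡 d) 𝓘(ℝ, ℝ) ∞ f)
    (hpos : ∀ x, 0 < f x) (hh : ContMDiff (𝓡 d) 𝓘(ℝ, ℝ) ∞ h) (q : ℝ) :
    ∫ x, f x ^ q * h x * hodgeLaplacian g f x ∂(riemVolume g) =
      ∫ x, (f x ^ q * innerDiff g h f x + q * f x ^ (q - 1) * h x * normDiffSq g f x)
        ∂(riemVolume g) := by
  refine (integral_mul_hodgeLaplacian g hf ((contMDiff_rpow hf hpos q).mul hh)).trans ?_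
  exact integral_congr_ae (Filter.Eventually.of_forall (innerDiff_rpow_mul g hf hpos hh q))

/-- The first-order form of the total modified scalar curvature. -/
lemma totalModScalar_eq {f φ : M → ℝ} (hf : ContMDiff (𝓡 d) 𝓘(ℝ, ℝ) ∞ f)
    (hpos : ∀ x, 0 < f x) (hφ : Continuous φ) (n k : ℝ) :
    totalModScalar g f k n φ =
      ∫ x, (φ x * f x ^ (k * (n - 2) / 2) + k ^ 2 / 4 * (n - 1) * (n - 2) *
        (f x ^ (k * (n - 2) / 2 - 2) * normDiffSq g f x)) ∂(riemVolume g) := by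
  set a := k * (n - 2) / 2 with ha
  have hN : Continuous (normDiffSq g f) := continuous_innerDiff g hf hf
  have hL := continuous_hodgeLaplacian g hf
  have hr (q : ℝ) : Continuous fun x => f x ^ q := (contMDiff_rpow hf hpos q).continuous
  -- With h = 1 and weight f^(a-1): ∫ f^(a-1) Δf = (a-1) ∫ f^(a-2) |df|².
  have hgreen := integral_rpow_mul_innerDiff g hf hpos contMDiff_const (q := a - 1) (h := fun _ => 1)
  simp only [innerDiff_const_left, mul_zero, zero_add, mul_one] at hgreen
  -- The last summand has zero integral by `hgreen`. The |df|² coefficients combine by (4 + 2k -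
  -- kn)/4 + (a - 1) = k(n-2)/4.
  have hpt (x : M) : modScalar g f k n φ x * f x ^ (n * k / 2) =
      (φ x * f x ^ a + k ^ 2 / 4 * (n - 1) * (n - 2) * (f x ^ (a - 2) * normDiffSq g f x)) +
      (k * (n - 1)) * (f x ^ (a - 1) * hodgeLaplacian g f x -
        (a - 1) * f x ^ (a - 1 - 1) * normDiffSq g f x) := by
    have hx := hpos x
    have e0 : f x ^ (-k) * f x ^ (n * k / 2) = f x ^ a := by
      rw [← Real.rpow_add hx]; congr 1; rw [ha]; ring
    have e1 : f x ^ (a - 1) = f x ^ a * (1 / f x) := by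
      rw [Real.rpow_sub_one hx.ne']; ring
    have e2 : f x ^ (a - 2) = f x ^ a * (1 / f x ^ 2) := by
      rw [Real.rpow_sub hx, Real.rpow_two]; ring
    have e3 : a - 1 - 1 = a - 2 := by ring
    rw [modScalar, e3, e1, e2, ← e0, ha]
    ring
  unfold totalModScalar
  simp only [hpt]
  rw [integral_add, integral_const_mul, integral_sub, hgreen, sub_self, mul_zero, add_zero]
  · exact ((hr _).mul hL).integrable_riemVolume g
  · exact ((continuous_const.mul (hr _)).mul hN).integrable_riemVolume g
  · exact ((hφ.mul (hr _)).add (continuous_const.mul ((hr _).mul hN))).integrable_riemVolume g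
  · exact (continuous_const.mul (((hr _).mul hL).sub
      ((continuous_const.mul (hr _)).mul hN))).integrable_riemVolume g

variable {J : Set ℝ} {F : ℝ → M → ℝ}

omit [T2Space M] in
lemma hasDerivAt_modVolume (hJ : IsOpen J) (hF : IsSmoothFamily d J F)
    (hpos : ∀ t ∈ J, ∀ x, 0 < F t x) (n k : ℝ) {t : ℝ} (ht : t ∈ J) :
    HasDerivAt (fun t => modVolume g (F t) k n) (n * k / 2 *
      ∫ x, F t x ^ (n * k / 2 - 1) * deriv (fun s => F s x) t ∂(riemVolume g)) t := by
  have hc := hF.continuousOn hJ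
  have hc' := (hF.timeDeriv hJ).continuousOn hJ
  have key := hasDerivAt_integral_of_continuousOn (μ := riemVolume g)
    (W := fun t x => F t x ^ (n * k / 2))
    (W' := fun t x => deriv (fun s => F s x) t * (n * k / 2) * F t x ^ (n * k / 2 - 1))
    hJ (fun t ht => (contMDiff_rpow (hF.contMDiff ht) (hpos t ht) _).continuous)
    ((hc'.mul continuousOn_const).mul (hc.rpow_const fun p hp => Or.inl (hpos _ hp.1 _).ne'))
    (fun t ht x => (hF.hasDerivAt hJ ht x).rpow_const (Or.inl (hpos t ht x).ne')) ht
  refine key.congr_deriv ?_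
  rw [← integral_const_mul]
  congr 1
  ext x
  ring

/-- With C = (k²/4)(n-1)(n-2), differentiating the first-order form produces 2C f^(a-2) ⟨dh, df⟩,
which Green's formula turns into 2C h (f^(a-2) Δf - (a-2) f^(a-3) |df|²). Since 2C = a k(n-1), the
terms reassemble into a multiple of the modified scalar curvature. -/
lemma hasDerivAt_totalModScalar (hJ : IsOpen J) (hF : IsSmoothFamily d J F)
    (hpos : ∀ t ∈ J, ∀ x, 0 < F t x) {φ : M → ℝ} (hφ : Continuous φ) (n k : ℝ) {t : ℝ}
    (ht : t ∈ J) :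
    HasDerivAt (fun t => totalModScalar g (F t) k n φ) (k * (n - 2) / 2 *
      ∫ x, F t x ^ (n * k / 2 - 1) * modScalar g (F t) k n φ x * deriv (fun s => F s x) t
        ∂(riemVolume g)) t := by
  set a := k * (n - 2) / 2 with ha
  set C := k ^ 2 / 4 * (n - 1) * (n - 2) with hC
  have hF' := hF.timeDeriv hJ
  have hc := hF.continuousOn hJ
  have hc' := hF'.continuousOn hJ
  have hcr (q : ℝ) : ContinuousOn (fun p : ℝ × M => F p.1 p.2 ^ q) (J ×ˢ Set.univ) :=
    hc.rpow_const fun p hp => Or.inl (hpos _ hp.1 _).ne'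
  have hcN : ContinuousOn (fun p : ℝ × M => normDiffSq g (F p.1) p.2) (J ×ˢ Set.univ) :=
    hF.continuousOn_innerDiff g hF hJ
  have hcI := hF'.continuousOn_innerDiff g hF hJ
  have hN {t : ℝ} (ht : t ∈ J) : Continuous (normDiffSq g (F t)) :=
    continuous_innerDiff g (hF.contMDiff ht) (hF.contMDiff ht)
  have hr {t : ℝ} (ht : t ∈ J) (q : ℝ) : Continuous fun x => F t x ^ q :=
    (contMDiff_rpow (hF.contMDiff ht) (hpos t ht) q).continuous
  have hdr {t : ℝ} (ht : t ∈ J) (x : M) (q : ℝ) : HasDerivAt (fun s => F s x ^ q)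
      (deriv (fun s => F s x) t * q * F t x ^ (q - 1)) t :=
    (hF.hasDerivAt hJ ht x).rpow_const (Or.inl (hpos t ht x).ne')
  have hdN {t : ℝ} (ht : t ∈ J) (x : M) : HasDerivAt (fun s => normDiffSq g (F s) x)
      (2 * innerDiff g (fun x => deriv (fun s => F s x) t) (F t) x) t :=
    hF.hasDerivAt_innerDiff_self g hJ ht x
  have key := hasDerivAt_integral_of_continuousOn (μ := riemVolume g)
    (W := fun t x => φ x * F t x ^ a + C * (F t x ^ (a - 2) * normDiffSq g (F t) x))
    hJ (fun t ht => (hφ.mul (hr ht _)).add (continuous_const.mul ((hr ht _).mul (hN ht))))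
    (((hφ.comp continuous_snd).continuousOn.mul ((hc'.mul continuousOn_const).mul
      (hcr (a - 1)))).add (continuousOn_const.mul ((((hc'.mul continuousOn_const).mul
        (hcr (a - 2 - 1))).mul hcN).add ((hcr (a - 2)).mul (continuousOn_const.mul hcI)))))
    (fun t ht x => ((hdr ht x a).const_mul (φ x)).add
      (((hdr ht x (a - 2)).mul (hdN ht x)).const_mul C)) ht
  have heq : (fun t => totalModScalar g (F t) k n φ) =ᶠ[𝓝 t] fun t => ∫ x,
      (φ x * F t x ^ a + C * (F t x ^ (a - 2) * normDiffSq g (F t) x)) ∂(riemVolume g) := by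
    filter_upwards [hJ.mem_nhds ht] with s hs
      using totalModScalar_eq g (hF.contMDiff hs) (hpos s hs) hφ n k
  refine (key.congr_of_eventuallyEq heq).congr_deriv ?_
  have hf := hF.contMDiff ht
  have hfpos := hpos t ht
  have hh := hF'.contMDiff ht
  have hgreen := integral_rpow_mul_innerDiff g hf hfpos hh (a - 2)
  have hI := continuous_innerDiff g hh hf
  have hL := continuous_hodgeLaplacian g hf
  have hhc := hh.continuous
  have hNt := hN ht
  have hrt := hr ht
  rw [← integral_const_mul, ← sub_eq_zero, ← integral_sub]
  rotate_left
  · exact ((hφ.mul ((hhc.mul continuous_const).mul (hrt _))).add (continuous_const.mul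
      ((((hhc.mul continuous_const).mul (hrt _)).mul hNt).add ((hrt _).mul
        (continuous_const.mul hI))))).integrable_riemVolume g
  · exact (continuous_const.mul (((hrt _).mul (continuous_modScalar g hf hfpos hφ n k)).mul
      hhc)).integrable_riemVolume g
  rw [← sub_eq_zero, ← integral_sub] at hgreen
  rotate_left
  · exact (((hrt _).mul hhc).mul hL).integrable_riemVolume g
  · exact (((hrt _).mul hI).add (((continuous_const.mul (hrt _)).mul hhc).mul
      hNt)).integrable_riemVolume g
  -- The right-hand side 0 is rewritten as -2C times the vanishing integral from Green's formula;
  -- the two integrands then agree pointwise.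
  rw [← mul_eq_zero_of_right (-(2 * C)) hgreen, ← integral_const_mul]
  congr 1
  ext x
  have hx := hfpos x
  have e0 : F t x ^ (n * k / 2 - 1) * F t x ^ (-k) = F t x ^ (a - 2) * F t x := by
    rw [← Real.rpow_add hx, ← Real.rpow_add_one hx.ne']; congr 1; rw [ha]; ring
  have e1 : F t x ^ (a - 1) = F t x ^ (a - 2) * F t x := by
    rw [← Real.rpow_add_one hx.ne']; congr 1; ring
  have e2 : F t x ^ (a - 2 - 1) = F t x ^ (a - 2) / F t x := Real.rpow_sub_one hx.ne' _
  rw [modScalar, ← mul_assoc (F t x ^ (n * k / 2 - 1)), e0, e1, e2, hC, ha]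
  field_simp
  ring

omit [T2Space M] in
lemma modVolume_pos [Nonempty M] {f : M → ℝ} (hf : ContMDiff (𝓡 d) 𝓘(ℝ, ℝ) ∞ f)
    (hpos : ∀ x, 0 < f x) (n k : ℝ) : 0 < modVolume g f k n := by
  have hc := (contMDiff_rpow hf hpos (n * k / 2)).continuous
  obtain ⟨x⟩ := ‹Nonempty M›
  exact hc.integral_pos_of_hasCompactSupport_nonneg_nonzero (HasCompactSupport.of_compactSpace _)
    (fun x => (Real.rpow_pos_of_pos (hpos x) _).le) (x := x) (Real.rpow_pos_of_pos (hpos x) _).ne'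

/-- The first variation of the functional `EH`. -/
theorem hasDerivAt_EH [Nonempty M] (hJ : IsOpen J) (hF : IsSmoothFamily d J F)
    (hpos : ∀ t ∈ J, ∀ x, 0 < F t x) {φ : M → ℝ} (hφ : Continuous φ) {n : ℝ} (hn : n ≠ 0) (k : ℝ)
    {t : ℝ} (ht : t ∈ J) :
    HasDerivAt (fun t => EH g (F t) k n φ)
      (k * (n - 2) / 2 / modVolume g (F t) k n ^ ((n - 2) / n) *
        ∫ x, deriv (fun s => F s x) t * (F t x ^ (n * k / 2 - 1) * (modScalar g (F t) k n φ x -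
          totalModScalar g (F t) k n φ / modVolume g (F t) k n)) ∂(riemVolume g)) t := by
  have hV := modVolume_pos g (hF.contMDiff ht) (hpos t ht) n k
  have key := (hasDerivAt_totalModScalar g hJ hF hpos hφ n k ht).div
    ((hasDerivAt_modVolume g hJ hF hpos n k ht).rpow_const (p := (n - 2) / n) (Or.inl hV.ne'))
    (Real.rpow_pos_of_pos hV _).ne'
  refine HasDerivAt.congr_deriv (f := fun t => EH g (F t) k n φ) key ?_
  have hh := ((hF.timeDeriv hJ).contMDiff ht).continuous
  have hr := (contMDiff_rpow (hF.contMDiff ht) (hpos t ht) (n * k / 2 - 1)).continuous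
  have hs := continuous_modScalar g (hF.contMDiff ht) (hpos t ht) hφ n k
  set S := totalModScalar g (F t) k n φ
  set V := modVolume g (F t) k n
  have hsplit : ∫ x, deriv (fun s => F s x) t * (F t x ^ (n * k / 2 - 1) *
      (modScalar g (F t) k n φ x - S / V)) ∂(riemVolume g) =
      (∫ x, F t x ^ (n * k / 2 - 1) * modScalar g (F t) k n φ x * deriv (fun s => F s x) t
        ∂(riemVolume g)) -
      S / V * ∫ x, F t x ^ (n * k / 2 - 1) * deriv (fun s => F s x) t ∂(riemVolume g) := by
    rw [← integral_const_mul, ← integral_sub]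
    · congr 1
      ext x
      ring
    · exact ((hr.mul hs).mul hh).integrable_riemVolume g
    · exact (continuous_const.mul (hr.mul hh)).integrable_riemVolume g
  -- The exponent (n-2)/n is the one for which the volume term carries (n-2)/n · nk/2 = k(n-2)/2,
  -- the same factor as the derivative of S.
  rw [hsplit, Real.rpow_sub_one hV.ne']
  have hVp := (Real.rpow_pos_of_pos hV ((n - 2) / n)).ne'
  have hV' := hV.ne'
  field_simp

end

/-! ### Critical points and constancy of the modified scalar curvature. -/

section

variable {d : ℕ} {M : Type*} [TopologicalSpace M] [ChartedSpace (EuclideanSpace ℝ (Fin d)) M]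
  [IsManifold (𝓡 d) ∞ M] (g : SmoothMetric d M) [CompactSpace M] [T2Space M]
  [MeasurableSpace M] [BorelSpace M]

lemma isCriticalPoint_of_modScalar_eq_const {f φ : M → ℝ} (hφ : Continuous φ)
    {n : ℝ} (hn : n ≠ 0) (k : ℝ) {c : ℝ} (hc : ∀ x, modScalar g f k n φ x = c) :
    IsCriticalPoint d (fun u : M → ℝ => EH g u k n φ) f := by
  intro ε F hε hF hpos h0
  rcases isEmpty_or_nonempty M with hM | hM
  -- On the empty manifold the volume is not positive, but there is only one function, so the
  -- functional is constant along any family.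
  · have : (fun t => EH g (F t) k n φ) = fun _ => EH g f k n φ :=
      funext fun t => congrArg (fun u => EH g u k n φ) (Subsingleton.elim _ _)
    rw [this]
    exact hasDerivAt_const _ _
  have ht : (0 : ℝ) ∈ Set.Ioo (-ε) ε := ⟨by linarith, hε⟩
  have hfam := IsSmoothFamily.of_contMDiffOn hF
  refine (hasDerivAt_EH g isOpen_Ioo hfam hpos hφ hn k ht).congr_deriv ?_
  have hV := modVolume_pos g (hfam.contMDiff ht) (hpos 0 ht) n k
  rw [← h0] at hc
  have hS : totalModScalar g (F 0) k n φ = c * modVolume g (F 0) k n := by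
    simp only [totalModScalar, modVolume, hc, integral_const_mul]
  rw [hS, mul_div_cancel_right₀ _ hV.ne']
  simp [hc]

omit [T2Space M] [MeasurableSpace M] [BorelSpace M] in
/-- A linear perturbation of a positive function stays positive for a short time. -/
lemma exists_pos_add_mul {f h : M → ℝ} (hf : Continuous f) (hpos : ∀ x, 0 < f x)
    (hh : Continuous h) : ∃ ε > 0, ∀ t ∈ Set.Ioo (-ε) ε, ∀ x, 0 < f x + t * h x := by
  rcases isEmpty_or_nonempty M with hM | hM
  · exact ⟨1, one_pos, fun _ _ x => (hM.false x).elim⟩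
  obtain ⟨x₀, -, hx₀⟩ := isCompact_univ.exists_isMinOn Set.univ_nonempty hf.continuousOn
  obtain ⟨B, hB⟩ := (isCompact_univ (X := M)).exists_bound_of_continuousOn hh.continuousOn
  have hB0 : 0 ≤ B := (norm_nonneg _).trans (hB x₀ (Set.mem_univ _))
  -- The minimum of f over a bound for |h|; adding 1 keeps the denominator positive.
  refine ⟨f x₀ / (B + 1), div_pos (hpos x₀) (by linarith), fun t ht x => ?_⟩
  have h1 : f x₀ ≤ f x := hx₀ (Set.mem_univ x)
  have h2 : |t| * (B + 1) < f x₀ := (lt_div_iff₀ (by linarith)).1 (abs_lt.2 ht)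
  have h3 : |t * h x| ≤ |t| * (B + 1) := by
    rw [abs_mul]
    exact mul_le_mul_of_nonneg_left ((hB x (Set.mem_univ x)).trans (by linarith)) (abs_nonneg t)
  linarith [neg_abs_le (t * h x)]

/-- Fundamental lemma of the calculus of variations: the linear variations f + t h show that
f^(nk/2-1) (s - S/Vol) is orthogonal to every smooth h, hence zero, being continuous. -/
lemma modScalar_eq_const_of_isCriticalPoint {f φ : M → ℝ} (hf : ContMDiff (𝓡 d) 𝓘(ℝ, ℝ) ∞ f)
    (hpos : ∀ x, 0 < f x) (hφ : Continuous φ) {n k : ℝ} (hn : n ≠ 0) (hn2 : n ≠ 2) (hk : k ≠ 0)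
    (hcrit : IsCriticalPoint d (fun u : M → ℝ => EH g u k n φ) f) (x : M) :
    modScalar g f k n φ x = totalModScalar g f k n φ / modVolume g f k n := by
  have : Nonempty M := ⟨x⟩
  set c := totalModScalar g f k n φ / modVolume g f k n with hc
  set u : M → ℝ := fun x => f x ^ (n * k / 2 - 1) * (modScalar g f k n φ x - c) with hu
  have huc : Continuous u := (contMDiff_rpow hf hpos _).continuous.mul
    ((continuous_modScalar g hf hpos hφ n k).sub continuous_const)
  have horth : ∀ h : M → ℝ, ContMDiff (𝓡 d) 𝓘(ℝ, ℝ) ∞ h → HasCompactSupport h →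
      ∫ x, h x • u x ∂(riemVolume g) = 0 := by
    intro h hh _
    obtain ⟨ε, hε, hεpos⟩ := exists_pos_add_mul hf.continuous hpos hh.continuous
    set F : ℝ → M → ℝ := fun t x => f x + t * h x with hFdef
    have hF : ContMDiffOn (𝓘(ℝ, ℝ).prod (𝓡 d)) 𝓘(ℝ, ℝ) ∞ (fun p : ℝ × M => F p.1 p.2)
        (Set.Ioo (-ε) ε ×ˢ Set.univ) :=
      ((hf.comp contMDiff_snd).add (contMDiff_fst.mul (hh.comp contMDiff_snd))).contMDiffOn
    have hF0 : F 0 = f := by ext; simp [hFdef]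
    have hd (x : M) : deriv (fun s => F s x) 0 = h x := by simp [hFdef]
    have ht : (0 : ℝ) ∈ Set.Ioo (-ε) ε := ⟨by linarith, hε⟩
    have h1 := hasDerivAt_EH g isOpen_Ioo (IsSmoothFamily.of_contMDiffOn hF) hεpos hφ hn k ht
    have h2 := h1.unique (hcrit ε F hε hF hεpos hF0)
    simp only [hd, hF0] at h2
    have hV := Real.rpow_pos_of_pos (modVolume_pos g hf hpos n k) ((n - 2) / n)
    refine (mul_eq_zero.1 h2).resolve_left (div_ne_zero ?_ hV.ne')
    exact div_ne_zero (mul_ne_zero hk (sub_ne_zero.2 hn2)) two_ne_zero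
  have hae := ae_eq_zero_of_integral_contMDiff_smul_eq_zero (𝓡 d)
    (huc.integrable_riemVolume g).locallyIntegrable horth
  have hzero : u = fun _ => 0 := (huc.ae_eq_iff_eq (riemVolume g) continuous_const).1 hae
  have hx := congrFun hzero x
  exact sub_eq_zero.1 ((mul_eq_zero.1 hx).resolve_left (Real.rpow_pos_of_pos (hpos x) _).ne')

end

end EinsteinHilbert

end

theorem proposition3p1 (d : ℕ) {M : Type*} [TopologicalSpace M] [CompactSpace M] [T2Space M]
    [ChartedSpace (EuclideanSpace ℝ (Fin d)) M] [IsManifold (𝓡 d) ∞ M]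
    [MeasurableSpace M] [BorelSpace M]
    (g : EinsteinHilbert.SmoothMetric d M)
    (n k : ℝ) (hn0 : n ≠ 0) (hn1 : n ≠ 1) (hn2 : n ≠ 2) (hk : k ≠ 0)
    (φ : M → ℝ) (hφ : ContMDiff (𝓡 d) 𝓘(ℝ, ℝ) ∞ φ)
    (f : M → ℝ) (hf : ContMDiff (𝓡 d) 𝓘(ℝ, ℝ) ∞ f) (hf_pos : ∀ x, 0 < f x) :
    (∃ c : ℝ, ∀ x, EinsteinHilbert.modScalar g f k n φ x = c) ↔
      EinsteinHilbert.IsCriticalPoint d (fun u : M → ℝ => EinsteinHilbert.EH g u k n φ) f := by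
  constructor
  · rintro ⟨c, hc⟩
    exact EinsteinHilbert.isCriticalPoint_of_modScalar_eq_const g hφ.continuous hn0 k hc
  · intro hcrit
    exact ⟨_, EinsteinHilbert.modScalar_eq_const_of_isCriticalPoint g hf hf_pos hφ.continuous hn0
      hn2 hk hcrit⟩
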